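/- Let $\omega=e^{2\pi i/3}$, $\tau=e^{-\pi i/3}$, $\Lambda=\omega\mathbb Z\oplus\mathbb Z\subset\mathbb C$, and let $V:\mathbb C\to\mathbb C$ be a real analytic function satisfying, for all $z\in\mathbb C$ and $\gamma\in\Lambda$, $$V(z)=V(-z),\qquad V(z+\gamma)=V(z),\qquad V(\omega z)=\omega^2V(z),\qquad \overline{V(\bar z)}=V(z).$$ For $\alpha,k\in\mathbb C$ put $P(\alpha,k)=(2D_{\bar z}+k)^2-\alpha^2V(z)$, where $2D_{\bar z}=\frac1i(\partial_{x_1}+i\partial_{x_2})$ and $z=x_1+ix_2$, and let $$\mathcal A=\{\alpha\in\mathbb C:\ \ker_{H^2(\mathbb C/\Lambda;\mathbb C)}P(\alpha,k)\neq\{0\}\ \text{ for every } k\in\mathbb C\}$$ be the set of parameters at which a flat band occurs. Let $\alpha\in\mathbb C$ and let $u=u(\alpha)$ be a protected state at $\alpha$, that is, $u\in\ker_{H^2(\mathbb C/\Lambda;\mathbb C)}P(\alpha,0)\setminus\{0\}$ and $u(\tau z)=u(z)$ (for instance, the value at $\alpha$ of a holomorphic family of such functions). Then $u$ is smooth (after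 modification on a null set), and with $\mathbf u(\alpha)=[2D_{\bar z}u,\,u]^t$, $$\alpha\in\mathcal A\quad\Longleftrightarrow\quad \exists\, z_0\in\mathbb C/\Lambda:\ \mathbf u(\alpha)(z_0)=0 .$$ -/

import Mathlib

namespace ScalarModel

open Complex MeasureTheory

noncomputable section

/-- `ω = e^{2πi/3}`. -/
def omega : ℂ := exp (2 * Real.pi * I / 3)

/-- `τ = e^{-πi/3}`. -/
def tau : ℂ := exp (-(Real.pi * I / 3))

/-- The lattice `Λ = ωℤ ⊕ ℤ`. -/
def lattice : Set ℂ := {γ | ∃ m n : ℤ, γ = m * omega + n}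

/-- The fundamental cell `{s + tω : 0 ≤ s, t < 1}` of `Λ`. -/
def cell : Set ℂ :=
  {z | ∃ s ∈ Set.Ico (0 : ℝ) 1, ∃ t ∈ Set.Ico (0 : ℝ) 1, z = s + t * omega}

/-- Functions on `ℂ/Λ`, seen as `Λ`-periodic functions on `ℂ`. -/
def IsLatticePeriodic (f : ℂ → ℂ) : Prop :=
  ∀ γ ∈ lattice, ∀ z, f (z + γ) = f z

/-- The standing assumptions on the potential: `V` is real analytic,
`V(z) = V(-z)`, `V(z + γ) = V(z)` for `γ ∈ Λ`, `V(ωz) = ω² V(z)` and `conj (V(conj z)) = V(z)`. -/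
structure IsScalarPotential (V : ℂ → ℂ) : Prop where
  analytic : AnalyticOnNhd ℝ V Set.univ
  even : ∀ z, V z = V (-z)
  periodic : IsLatticePeriodic V
  rotation : ∀ z, V (omega * z) = omega ^ 2 * V z
  reflection : ∀ z, (starRingEnd ℂ) (V ((starRingEnd ℂ) z)) = V z

/-- `f ∈ L²(ℂ/Λ; ℂ)`. -/
def MemL2 (f : ℂ → ℂ) : Prop :=
  IsLatticePeriodic f ∧ MemLp f 2 (volume.restrict cell)

/-- `g` is the weak (distributional) derivative of `f` on `ℂ = ℝ²` in the direction `e`. -/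
def HasWeakPartial (e : ℂ) (f g : ℂ → ℂ) : Prop :=
  LocallyIntegrable f ∧ LocallyIntegrable g ∧
    ∀ φ : ℂ → ℂ, ContDiff ℝ (⊤ : ℕ∞) φ → HasCompactSupport φ →
      ∫ z, f z * fderiv ℝ φ z e = -∫ z, g z * φ z

/-- `f ∈ Hᵐ(ℂ/Λ; ℂ)`: `f` and its weak partial derivatives of order at most `m` are in
`L²(ℂ/Λ; ℂ)`. -/
def MemSobolev : ℕ → (ℂ → ℂ) → Prop
  | 0, f => MemL2 f
  | m + 1, f => MemL2 f ∧ ∃ g₁ g₂ : ℂ → ℂ,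
      HasWeakPartial 1 f g₁ ∧ HasWeakPartial I f g₂ ∧ MemSobolev m g₁ ∧ MemSobolev m g₂

/-- `g = (2D_{z̄} + k) f` in the weak sense, where `2D_{z̄} = (1/i)(∂_{x₁} + i∂_{x₂})`. -/
def IsWeakTwoDbarAdd (k : ℂ) (f g : ℂ → ℂ) : Prop :=
  ∃ g₁ g₂ : ℂ → ℂ, HasWeakPartial 1 f g₁ ∧ HasWeakPartial I f g₂ ∧
    ∀ᵐ z, g z = (1 / I) * (g₁ z + I * g₂ z) + k * f z

/-- `u` lies in the kernel of `P(α, k) = (2D_{z̄} + k)² - α² V` on `H²(ℂ/Λ; ℂ)`. -/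
def MemKerP (V : ℂ → ℂ) (α k : ℂ) (u : ℂ → ℂ) : Prop :=
  MemSobolev 2 u ∧ ∃ v w : ℂ → ℂ,
    IsWeakTwoDbarAdd k u v ∧ IsWeakTwoDbarAdd k v w ∧
      ∀ᵐ z, w z - α ^ 2 * V z * u z = 0

/-- `u` is not the zero element of `L²(ℂ/Λ; ℂ)`. -/
def IsNonzero (u : ℂ → ℂ) : Prop := ¬ (∀ᵐ z, u z = 0)

/-- The set `𝒜` of those `α` at which a flat band occurs:
`ker P(α, k) ≠ {0}` on `H²(ℂ/Λ; ℂ)` for every `k ∈ ℂ`. -/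
def magicSet (V : ℂ → ℂ) : Set ℂ :=
  {α | ∀ k : ℂ, ∃ u : ℂ → ℂ, MemKerP V α k u ∧ IsNonzero u}

/-- `u` is a protected state at `α`: `u ∈ ker P(α, 0) \ {0}` and `u` belongs to the space
`L²₀(ℂ/Λ; ℂ)` of functions with `u(τz) = u(z)`. -/
structure IsProtectedState (V : ℂ → ℂ) (α : ℂ) (u : ℂ → ℂ) : Prop where
  memKer : MemKerP V α 0 u
  nonzero : IsNonzero u
  symmetric : ∀ᵐ z, u (tau * z) = u z

/-- The classical operator `2D_{z̄} = (1/i)(∂_{x₁} + i∂_{x₂})`. -/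
def twoDbar (f : ℂ → ℂ) (z : ℂ) : ℂ :=
  (1 / I) * (fderiv ℝ f z 1 + I * fderiv ℝ f z I)

/-- The vector `[2D_{z̄} u, u]ᵗ` attached to a differentiable function `u`. -/
def protectedVector (u : ℂ → ℂ) (z : ℂ) : Fin 2 → ℂ := ![twoDbar u z, u z]

end

end ScalarModel

namespace ScalarModel

open Complex MeasureTheory

noncomputable section

/-! ### Plane waves -/

/-! The argument runs in Fourier space on `ℂ/Λ`. The character `chr n` is an eigenfunction of
`2D_{z̄}` with eigenvalue `dualPt n`, so membership in `ker P(α, k)` becomes `(κₙ + k)² aₙ = α² (a *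
V̂)ₙ` for the coefficients (`MemKerP.coeff_eq`, and conversely `memKerP_series`). Bounded solutions
of this equation gain one power of decay at a time (`rapid_of_sq_mul_eq`), so `u` agrees almost
everywhere with the smooth function `series (coeff u)`.

A flat band forces a zero. For `-k` outside the dual lattice, `2D_{z̄} + k` is injective on smooth
periodic functions. Take `v` in `ker P(α, 1)`, and let `u'` and `v'` be the images of `u` and `v`
under `2D_{z̄}` and `2D_{z̄} + 1`. The Wronskian `u v' - v u'` is annihilated by `2D_{z̄} + 1`,
hence is zero. If `(u, u')` had no zero, then `(v, v') = f · (u, u')` with `f` smooth and periodic;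
`f` is annihilated as well, so `v = 0` (`eq_zero_of_system`).

A zero produces a flat band. If `-k` is in the dual lattice, multiply `u` by a character. Otherwise
let `F` be the fundamental solution of `2D_{z̄} + k` with pole at the zero `z₀`. Since `(2D_{z̄} +
k)(F b)` is `F · 2D_{z̄} b` plus a multiple of `b(z₀) δ`, the vanishing of `u` and `2D_{z̄} u` at
`z₀` removes both point masses, and `(2D_{z̄} + k)²(F u) = F (2D_{z̄})² u = α² V F u`. Here `F` is
only a sequence of coefficients and products are convolutions, so no distributions are needed.

The delicate point is `F u ≠ 0` (`conv_greenCoeff_ne_zero`). Let `s` be a trigonometric polynomial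
vanishing to fourth order at `z₀` and only on `z₀ + Λ`. If `F u = 0`, then `g = F s` satisfies `g u
= 0`, so it vanishes on an open set; off `z₀ + Λ` the quotient `g / s` is holomorphic up to a plane
wave factor, so `g = 0`. But `F s = 0` forces every `(2D_{z̄})ʲ s` to vanish at `z₀`, which fails
for `j = 4`. -/

/-- The real linear form `z ↦ Re (κ z̄)`. -/
def phase (κ : ℂ) : ℂ →L[ℝ] ℝ := κ.re • reCLM + κ.im • imCLM

/-- The plane wave `z ↦ exp (i Re (κ z̄))`, an eigenfunction of `2D_{z̄}` with eigenvalue `κ`. -/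
def planeWave (κ z : ℂ) : ℂ := exp (I * (phase κ z : ℝ))

lemma phase_apply (κ z : ℂ) : phase κ z = κ.re * z.re + κ.im * z.im := by
  simp [phase]

lemma planeWave_add_left (κ μ z : ℂ) :
    planeWave (κ + μ) z = planeWave κ z * planeWave μ z := by
  simp only [planeWave, phase_apply, ← Complex.exp_add]
  congr 1
  push_cast [add_re, add_im]
  ring

lemma planeWave_add_right (κ z w : ℂ) :
    planeWave κ (z + w) = planeWave κ z * planeWave κ w := by
  simp only [planeWave, map_add, ← Complex.exp_add]
  congr 1
  push_cast
  ring

@[simp] lemma planeWave_zero_left (z : ℂ) : planeWave 0 z = 1 := by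
  simp [planeWave, phase_apply]

@[simp] lemma planeWave_zero_right (κ : ℂ) : planeWave κ 0 = 1 := by
  simp [planeWave]

@[simp] lemma norm_planeWave (κ z : ℂ) : ‖planeWave κ z‖ = 1 := by
  rw [planeWave, mul_comm, norm_exp_ofReal_mul_I]

lemma planeWave_ne_zero (κ z : ℂ) : planeWave κ z ≠ 0 := exp_ne_zero _

lemma planeWave_neg_left_mul (κ z : ℂ) : planeWave (-κ) z * planeWave κ z = 1 := by
  rw [← planeWave_add_left, neg_add_cancel, planeWave_zero_left]

lemma hasFDerivAt_planeWave (κ z : ℂ) :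
    HasFDerivAt (planeWave κ) ((planeWave κ z * I) • (ofRealCLM.comp (phase κ))) z := by
  have h1 : HasFDerivAt (fun z : ℂ => I * ((phase κ z : ℝ) : ℂ))
      (I • (ofRealCLM.comp (phase κ))) z :=
    ((ofRealCLM.comp (phase κ)).hasFDerivAt).const_mul I
  have h2 := h1.cexp
  rw [smul_smul] at h2
  exact h2

lemma contDiff_planeWave (κ : ℂ) {n : ℕ∞} : ContDiff ℝ n (planeWave κ) := by
  unfold planeWave
  have : ContDiff ℝ n (fun z : ℂ => I * ((phase κ z : ℝ) : ℂ)) :=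
    contDiff_const.mul (ofRealCLM.contDiff.comp (phase κ).contDiff)
  exact this.cexp

lemma continuous_planeWave (κ : ℂ) : Continuous (planeWave κ) :=
  (contDiff_planeWave κ (n := 0)).continuous

/-! ### The operator `2D_{z̄}` -/

lemma HasFDerivAt.twoDbar_eq {f : ℂ → ℂ} {f' : ℂ →L[ℝ] ℂ} {z : ℂ} (h : HasFDerivAt f f' z) :
    twoDbar f z = (1 / I) * (f' 1 + I * f' I) := by
  rw [twoDbar, h.fderiv]

lemma twoDbar_planeWave (κ z : ℂ) : twoDbar (planeWave κ) z = κ * planeWave κ z := by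
  rw [HasFDerivAt.twoDbar_eq (hasFDerivAt_planeWave κ z)]
  simp only [smul_apply, ContinuousLinearMap.comp_apply, smul_eq_mul, phase_apply,
    ofRealCLM_apply, one_re, one_im, I_re, I_im, mul_one, mul_zero, add_zero, zero_add, one_div,
    inv_I]
  linear_combination (-planeWave κ z * κ.re - planeWave κ z * κ.im * I) * I_sq +
    planeWave κ z * re_add_im κ

lemma twoDbar_mul {f g : ℂ → ℂ} {z : ℂ} (hf : DifferentiableAt ℝ f z)
    (hg : DifferentiableAt ℝ g z) :
    twoDbar (fun z => f z * g z) z = f z * twoDbar g z + g z * twoDbar f z := by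
  rw [HasFDerivAt.twoDbar_eq (hf.hasFDerivAt.fun_mul hg.hasFDerivAt)]
  simp only [twoDbar, add_apply, smul_apply, smul_eq_mul]
  ring

lemma twoDbar_add {f g : ℂ → ℂ} {z : ℂ} (hf : DifferentiableAt ℝ f z)
    (hg : DifferentiableAt ℝ g z) :
    twoDbar (fun z => f z + g z) z = twoDbar f z + twoDbar g z := by
  rw [HasFDerivAt.twoDbar_eq (hf.hasFDerivAt.fun_add hg.hasFDerivAt)]
  simp only [twoDbar, add_apply]
  ring

lemma twoDbar_const_mul {f : ℂ → ℂ} {z : ℂ} (c : ℂ) (hf : DifferentiableAt ℝ f z) :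
    twoDbar (fun z => c * f z) z = c * twoDbar f z := by
  rw [HasFDerivAt.twoDbar_eq (hf.hasFDerivAt.const_mul c)]
  simp only [twoDbar, smul_apply, smul_eq_mul]
  ring

/-! ### The dual lattice -/

/-- The points of the dual lattice `{κ : Re (κ γ̄) ∈ 2πℤ for all γ ∈ Λ}`. -/
def dualPt (n : Fin 2 → ℤ) : ℂ :=
  ⟨2 * Real.pi * n 0, 2 * Real.pi * (2 * n 1 + n 0) / √3⟩

lemma dualPt_add (m n : Fin 2 → ℤ) : dualPt (m + n) = dualPt m + dualPt n := by
  apply Complex.ext <;> simp [dualPt] <;> ring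

lemma dualPt_neg (n : Fin 2 → ℤ) : dualPt (-n) = -dualPt n := by
  apply Complex.ext <;> simp [dualPt] <;> ring

lemma dualPt_sub (m n : Fin 2 → ℤ) : dualPt (m - n) = dualPt m - dualPt n := by
  rw [sub_eq_add_neg, dualPt_add, dualPt_neg, sub_eq_add_neg]

@[simp] lemma dualPt_zero : dualPt 0 = 0 := by
  apply Complex.ext
  · simp [dualPt]
  · simp [dualPt]

lemma omega_eq : omega = ⟨-1 / 2, √3 / 2⟩ := by
  have h : (2 * Real.pi * I / 3 : ℂ) = ((2 * Real.pi / 3 : ℝ) : ℂ) * I := by push_cast; ring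
  have h3 : (2 * Real.pi / 3 : ℝ) = Real.pi - Real.pi / 3 := by ring
  rw [omega, h]
  apply Complex.ext
  · rw [exp_ofReal_mul_I_re, h3, Real.cos_pi_sub, Real.cos_pi_div_three]; norm_num
  · rw [exp_ofReal_mul_I_im, h3, Real.sin_pi_sub, Real.sin_pi_div_three]

/-- This identity dictates the coordinates in `dualPt`: they form the basis dual to `(1, ω)`, scaled
by `2π`. -/
lemma phase_dualPt (n : Fin 2 → ℤ) (s t : ℝ) :
    phase (dualPt n) (s + t * omega) = 2 * Real.pi * (n 0 * s + n 1 * t) := by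
  have h3 : √3 ≠ 0 := by positivity
  rw [phase_apply, omega_eq, dualPt]
  simp
  field_simp
  ring

/-- The characters of `ℂ/Λ`. -/
def chr (n : Fin 2 → ℤ) (z : ℂ) : ℂ := planeWave (dualPt n) z

lemma chr_add_left (m n : Fin 2 → ℤ) (z : ℂ) : chr (m + n) z = chr m z * chr n z := by
  rw [chr, dualPt_add, planeWave_add_left]; rfl

lemma chr_add_right (n : Fin 2 → ℤ) (z w : ℂ) : chr n (z + w) = chr n z * chr n w :=
  planeWave_add_right _ _ _

@[simp] lemma chr_zero_left (z : ℂ) : chr 0 z = 1 := by simp [chr]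

@[simp] lemma norm_chr (n : Fin 2 → ℤ) (z : ℂ) : ‖chr n z‖ = 1 := norm_planeWave _ _

lemma chr_apply (n : Fin 2 → ℤ) (s t : ℝ) :
    chr n (s + t * omega) = exp (2 * Real.pi * I * (n 0 * s + n 1 * t)) := by
  rw [chr, planeWave, phase_dualPt]
  congr 1
  push_cast
  ring

lemma chr_of_mem_lattice (n : Fin 2 → ℤ) {γ : ℂ} (hγ : γ ∈ lattice) : chr n γ = 1 := by
  obtain ⟨p, q, rfl⟩ := hγ
  have := chr_apply n q p
  push_cast at this
  rw [add_comm, this, exp_eq_one_iff]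
  exact ⟨n 0 * q + n 1 * p, by push_cast; ring⟩

lemma isLatticePeriodic_chr (n : Fin 2 → ℤ) : IsLatticePeriodic (chr n) := fun γ hγ z => by
  rw [chr_add_right, chr_of_mem_lattice n hγ, mul_one]

lemma contDiff_chr (n : Fin 2 → ℤ) {m : ℕ∞} : ContDiff ℝ m (chr n) := contDiff_planeWave _

lemma continuous_chr (n : Fin 2 → ℤ) : Continuous (chr n) := continuous_planeWave _

/-- The weight `1 + |κ|` on the dual lattice. -/
def weight (n : Fin 2 → ℤ) : ℝ := 1 + ‖dualPt n‖

lemma one_le_weight (n : Fin 2 → ℤ) : 1 ≤ weight n := by simp [weight]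

lemma weight_pos (n : Fin 2 → ℤ) : 0 < weight n := zero_lt_one.trans_le (one_le_weight n)

lemma norm_dualPt_le_weight (n : Fin 2 → ℤ) : ‖dualPt n‖ ≤ weight n := by simp [weight]

/-- Submultiplicativity of the weight is what makes convolution preserve polynomial decay. -/
lemma weight_le_mul (m n : Fin 2 → ℤ) : weight m ≤ weight (m - n) * weight n := by
  have h : ‖dualPt m‖ ≤ ‖dualPt (m - n)‖ + ‖dualPt n‖ := by
    rw [dualPt_sub]; simpa using norm_add_le (dualPt m - dualPt n) (dualPt n)
  unfold weight
  nlinarith [norm_nonneg (dualPt (m - n)), norm_nonneg (dualPt n)]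

lemma norm_le_weight (n : Fin 2 → ℤ) : ‖n‖ ≤ weight n := by
  have hpi : 3 < Real.pi := Real.pi_gt_three
  have h3 : √3 ≤ 2 := by rw [Real.sqrt_le_left (by norm_num)]; norm_num
  have h3' : 0 < √3 := by positivity
  have hre : |(n 0 : ℝ)| ≤ ‖dualPt n‖ / 6 := by
    have := abs_re_le_norm (dualPt n)
    simp only [dualPt, abs_mul, abs_of_pos Real.pi_pos, Nat.abs_ofNat] at this ⊢
    nlinarith [abs_nonneg (n 0 : ℝ)]
  have him : |(2 * n 1 + n 0 : ℝ)| ≤ ‖dualPt n‖ / 3 := by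
    have := abs_im_le_norm (dualPt n)
    simp only [dualPt, abs_mul, abs_div, abs_of_pos Real.pi_pos, Nat.abs_ofNat, abs_of_pos h3']
      at this ⊢
    rw [div_le_iff₀ h3'] at this
    nlinarith [abs_nonneg (2 * n 1 + n 0 : ℝ), norm_nonneg
      (⟨2 * Real.pi * n 0, 2 * Real.pi * (2 * n 1 + n 0) / √3⟩ : ℂ)]
  have h1 : |(n 1 : ℝ)| ≤ ‖dualPt n‖ := by
    have h2 : (2 * n 1 : ℝ) = (2 * n 1 + n 0) - n 0 := by ring
    have := abs_sub (2 * n 1 + n 0 : ℝ) (n 0)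
    rw [← h2, abs_mul, Nat.abs_ofNat] at this
    linarith [norm_nonneg (dualPt n), abs_nonneg (n 1 : ℝ)]
  refine (pi_norm_le_iff_of_nonneg (weight_pos n).le).2 fun i => ?_
  rw [Int.norm_eq_abs]
  have := norm_dualPt_le_weight n
  fin_cases i
  · exact le_trans hre (by linarith [norm_nonneg (dualPt n)])
  · exact h1.trans this

lemma summable_inv_weight : Summable fun n => ((weight n) ^ 3)⁻¹ := by
  have h := EisensteinSeries.summable_one_div_norm_rpow (k := 3) (by norm_num)
  have h' : Summable fun n : Fin 2 → ℤ => ‖n‖ ^ (-3 : ℝ) := h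
  -- The real power `‖0‖ ^ (-3)` is `0` by convention while `weight 0 = 1`, so an indicator at `0`
  -- is added to the majorant.
  refine (h'.add (summable_of_hasFiniteSupport (f := fun n : Fin 2 → ℤ => if n = 0 then (1:ℝ) else 0)
    ((Set.finite_singleton 0).subset fun n hn => by simpa using hn))).of_nonneg_of_le
    (fun n => by have := weight_pos n; positivity) fun n => ?_
  by_cases hn : n = 0
  · subst hn; simp [weight]
  · have : 0 < ‖n‖ := norm_pos_iff.2 hn
    rw [if_neg hn, add_zero, Real.rpow_neg this.le]
    have := norm_le_weight n
    have e : ‖n‖ ^ (3 : ℝ) = ‖n‖ ^ 3 := by exact_mod_cast Real.rpow_natCast ‖n‖ 3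
    rw [e]
    gcongr

section Sequences

/-! ### Sequences on the dual lattice -/

/-- `a n = O((1 + |κ n|) ^ (-m))`. -/
def Decay (m : ℕ) (a : (Fin 2 → ℤ) → ℂ) : Prop := ∃ C, ∀ n, weight n ^ m * ‖a n‖ ≤ C

/-- Decay faster than any power. -/
def Rapid (a : (Fin 2 → ℤ) → ℂ) : Prop := ∀ m, Decay m a

/-- Convolution of sequences on the dual lattice. -/
def conv (a b : (Fin 2 → ℤ) → ℂ) (n : Fin 2 → ℤ) : ℂ := ∑' m, a (n - m) * b m

/-- The Fourier series with coefficients `a`. -/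
def series (a : (Fin 2 → ℤ) → ℂ) (z : ℂ) : ℂ := ∑' n, a n * chr n z

variable {a b c : (Fin 2 → ℤ) → ℂ} {m p : ℕ} {k : ℂ}

lemma decay_zero_iff : Decay 0 a ↔ ∃ C, ∀ n, ‖a n‖ ≤ C := by simp [Decay]

lemma Decay.mono (h : Decay m a) (hp : p ≤ m) : Decay p a := by
  obtain ⟨C, hC⟩ := h
  refine ⟨C, fun n => le_trans ?_ (hC n)⟩
  gcongr
  exact one_le_weight n

lemma Decay.add (ha : Decay m a) (hb : Decay m b) : Decay m (fun n => a n + b n) := by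
  obtain ⟨A, hA⟩ := ha
  obtain ⟨B, hB⟩ := hb
  refine ⟨A + B, fun n => ?_⟩
  have := pow_pos (weight_pos n) m
  nlinarith [hA n, hB n, norm_add_le (a n) (b n)]

lemma Decay.const_mul (x : ℂ) (ha : Decay m a) : Decay m (fun n => x * a n) := by
  obtain ⟨A, hA⟩ := ha
  refine ⟨‖x‖ * A, fun n => ?_⟩
  rw [norm_mul]
  nlinarith [hA n, norm_nonneg x]

lemma Decay.summable_weight (h : Decay (m + 3) a) :
    Summable fun n => weight n ^ m * ‖a n‖ := by
  obtain ⟨C, hC⟩ := h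
  refine (summable_inv_weight.mul_left C).of_nonneg_of_le
    (fun n => by have := weight_pos n; positivity) fun n => ?_
  have := weight_pos n
  rw [← div_eq_mul_inv, le_div_iff₀ (by positivity)]
  calc _ = weight n ^ (m + 3) * ‖a n‖ := by ring
    _ ≤ C := hC n

lemma Decay.summable (h : Decay 3 a) : Summable fun n => ‖a n‖ := by
  simpa using Decay.summable_weight (m := 0) h

lemma Rapid.summable (h : Rapid a) : Summable fun n => ‖a n‖ := (h 3).summable

lemma Rapid.const_mul (x : ℂ) (ha : Rapid a) : Rapid (fun n => x * a n) :=
  fun m => (ha m).const_mul x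

lemma Rapid.add (ha : Rapid a) (hb : Rapid b) : Rapid (fun n => a n + b n) :=
  fun m => (ha m).add (hb m)

lemma Decay.mul_of_le_weight (ha : Decay (m + 1) a) (hb : ∀ n, ‖b n‖ ≤ weight n) :
    Decay m (fun n => b n * a n) := by
  obtain ⟨C, hC⟩ := ha
  refine ⟨C, fun n => le_trans ?_ (hC n)⟩
  rw [norm_mul, pow_succ, mul_assoc]
  have := weight_pos n
  gcongr
  exact hb n

lemma Rapid.dualPt_mul (ha : Rapid a) : Rapid (fun n => dualPt n * a n) :=
  fun m => (ha (m + 1)).mul_of_le_weight norm_dualPt_le_weight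

lemma weight_le_add (n : Fin 2 → ℤ) (k : ℂ) : weight n ≤ (1 + ‖k‖) + ‖dualPt n + k‖ := by
  have : ‖dualPt n‖ ≤ ‖dualPt n + k‖ + ‖k‖ := by
    simpa using norm_sub_le (dualPt n + k) k
  unfold weight
  linarith

/-- Ellipticity: `|κₙ + k|` is comparable to the weight up to an additive constant, so control of
`(2D_{z̄} + k)` gains one order of decay. -/
lemma Decay.succ_of_mul_add (ha : Decay m a) (hb : Decay m fun n => (dualPt n + k) * a n) :
    Decay (m + 1) a := by
  obtain ⟨A, hA⟩ := ha
  obtain ⟨B, hB⟩ := hb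
  refine ⟨(1 + ‖k‖) * A + B, fun n => ?_⟩
  have h1 := hA n
  have h2 := hB n
  have hw := weight_le_add n k
  rw [norm_mul] at h2
  have h0 : 0 ≤ weight n ^ m * ‖a n‖ := by have := weight_pos n; positivity
  calc weight n ^ (m + 1) * ‖a n‖ = weight n * (weight n ^ m * ‖a n‖) := by ring
    _ ≤ ((1 + ‖k‖) + ‖dualPt n + k‖) * (weight n ^ m * ‖a n‖) := by gcongr
    _ = (1 + ‖k‖) * (weight n ^ m * ‖a n‖) +
        weight n ^ m * (‖dualPt n + k‖ * ‖a n‖) := by ring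
    _ ≤ (1 + ‖k‖) * A + B := by gcongr

/-- A gain of one order is enough for the bootstrap, so the crude bound `x ≤ 1 + x²` with `x = |κₙ +
k|` is used. -/
lemma Decay.succ_of_sq_mul (ha : Decay m a) (hb : Decay m fun n => (dualPt n + k) ^ 2 * a n) :
    Decay (m + 1) a := by
  obtain ⟨A, hA⟩ := ha
  obtain ⟨B, hB⟩ := hb
  refine ⟨(2 + ‖k‖) * A + B, fun n => ?_⟩
  have h1 := hA n
  have h2 := hB n
  have hw := weight_le_add n k
  rw [norm_mul, norm_pow] at h2
  have h0 : 0 ≤ weight n ^ m * ‖a n‖ := by have := weight_pos n; positivity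
  have hsq : ‖dualPt n + k‖ ≤ 1 + ‖dualPt n + k‖ ^ 2 := by
    nlinarith [sq_nonneg (‖dualPt n + k‖ - 1), norm_nonneg (dualPt n + k)]
  calc weight n ^ (m + 1) * ‖a n‖ = weight n * (weight n ^ m * ‖a n‖) := by ring
    _ ≤ ((2 + ‖k‖) + ‖dualPt n + k‖ ^ 2) * (weight n ^ m * ‖a n‖) := by
      gcongr; linarith
    _ = (2 + ‖k‖) * (weight n ^ m * ‖a n‖) +
        weight n ^ m * (‖dualPt n + k‖ ^ 2 * ‖a n‖) := by ring
    _ ≤ (2 + ‖k‖) * A + B := by gcongr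

/-! ### Convolution -/

lemma summable_norm_conv (ha : Decay 0 a) (hb : Summable fun n => ‖b n‖) (n : Fin 2 → ℤ) :
    Summable fun m => ‖a (n - m) * b m‖ := by
  obtain ⟨A, hA⟩ := decay_zero_iff.1 ha
  refine (hb.mul_left A).of_nonneg_of_le (fun _ => norm_nonneg _) fun m => ?_
  rw [norm_mul]
  gcongr
  exact hA _

lemma Decay.conv_of_summable (ha : Decay m a) (hb : Summable fun n => weight n ^ m * ‖b n‖) :
    Decay m (conv a b) := by
  have hb' : Summable fun n => ‖b n‖ := by
    refine hb.of_nonneg_of_le (fun _ => norm_nonneg _) fun n => ?_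
    have := one_le_pow₀ (one_le_weight n) (n := m)
    nlinarith [norm_nonneg (b n)]
  have hs := summable_norm_conv (ha.mono (Nat.zero_le _)) hb'
  obtain ⟨A, hA⟩ := ha
  refine ⟨A * ∑' n, weight n ^ m * ‖b n‖, fun n => ?_⟩
  have := weight_pos n
  calc weight n ^ m * ‖conv a b n‖
      ≤ weight n ^ m * ∑' l, ‖a (n - l) * b l‖ := by
        gcongr; exact norm_tsum_le_tsum_norm (hs n)
    _ = ∑' l, weight n ^ m * ‖a (n - l) * b l‖ := tsum_mul_left.symm
    _ ≤ ∑' l, A * (weight l ^ m * ‖b l‖) := by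
        refine ((hs n).mul_left _).tsum_le_tsum (fun l => ?_) (hb.mul_left A)
        have h1 := weight_pos l
        have h2 := weight_pos (n - l)
        calc weight n ^ m * ‖a (n - l) * b l‖
            ≤ (weight (n - l) * weight l) ^ m * ‖a (n - l) * b l‖ := by
              gcongr; exact weight_le_mul n l
          _ = (weight (n - l) ^ m * ‖a (n - l)‖) * (weight l ^ m * ‖b l‖) := by
              rw [norm_mul]; ring
          _ ≤ A * (weight l ^ m * ‖b l‖) := by gcongr; exact hA _
    _ = A * ∑' n, weight n ^ m * ‖b n‖ := tsum_mul_left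

lemma Decay.conv (ha : Decay m a) (hb : Rapid b) : Decay m (conv a b) :=
  ha.conv_of_summable (hb (m + 3)).summable_weight

lemma summable_norm_prod (ha : Decay 0 a) (hb : Summable fun n => ‖b n‖)
    (hc : Summable fun n => ‖c n‖) (f : (Fin 2 → ℤ) → (Fin 2 → ℤ) → (Fin 2 → ℤ)) :
    Summable fun q : (Fin 2 → ℤ) × (Fin 2 → ℤ) => ‖a (f q.1 q.2) * (b q.1 * c q.2)‖ := by
  obtain ⟨A, hA⟩ := decay_zero_iff.1 ha
  refine ((hb.mul_of_nonneg hc (fun _ => norm_nonneg _) (fun _ => norm_nonneg _)).mul_left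
    A).of_nonneg_of_le (fun _ => norm_nonneg _) fun q => ?_
  rw [norm_mul, norm_mul]
  gcongr
  exact hA _

lemma conv_conv_eq_tsum (ha : Decay 0 a) (hb : Summable fun n => ‖b n‖)
    (hc : Summable fun n => ‖c n‖) (n : Fin 2 → ℤ) :
    conv (conv a b) c n =
      ∑' q : (Fin 2 → ℤ) × (Fin 2 → ℤ), a (n - q.1 - q.2) * (b q.1 * c q.2) := by
  have hs := (summable_norm_prod ha hb hc (fun x y => n - x - y)).of_norm
  have hs' := hs.prod_symm
  rw [← (Equiv.prodComm _ _).tsum_eq]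
  simp only [Equiv.prodComm_apply]
  rw [hs'.tsum_prod, conv]
  refine tsum_congr fun l => ?_
  rw [conv, ← tsum_mul_right]
  refine tsum_congr fun j => ?_
  simp only [Prod.swap_prod_mk]
  rw [sub_right_comm]
  ring

/-- Both sides are the same absolutely convergent double sum with its indices swapped. The factor
`a` need only be bounded, so it may be the coefficient sequence of a distribution. -/
lemma conv_right_comm (ha : Decay 0 a) (hb : Summable fun n => ‖b n‖)
    (hc : Summable fun n => ‖c n‖) : conv (conv a b) c = conv (conv a c) b := by
  ext n
  rw [conv_conv_eq_tsum ha hb hc, conv_conv_eq_tsum ha hc hb, ← (Equiv.prodComm _ _).tsum_eq]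
  refine tsum_congr fun q => ?_
  simp only [Equiv.prodComm_apply, Prod.fst_swap, Prod.snd_swap]
  rw [sub_right_comm, mul_comm (b _)]

lemma conv_assoc (ha : Decay 0 a) (hb : Summable fun n => ‖b n‖)
    (hc : Summable fun n => ‖c n‖) : conv (conv a b) c = conv a (conv b c) := by
  ext n
  -- Substituting `q.1 - q.2` for `q.1` makes the first index the one at which `conv b c` is
  -- evaluated.
  let e : (Fin 2 → ℤ) × (Fin 2 → ℤ) ≃ (Fin 2 → ℤ) × (Fin 2 → ℤ) :=
    { toFun := fun q => (q.1 - q.2, q.2)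
      invFun := fun q => (q.1 + q.2, q.2)
      left_inv := fun q => by simp
      right_inv := fun q => by simp }
  have hs := (summable_norm_prod ha hb hc (fun x y => n - x - y)).of_norm
  have hs' : Summable ((fun q : (Fin 2 → ℤ) × (Fin 2 → ℤ) =>
      a (n - q.1 - q.2) * (b q.1 * c q.2)) ∘ e) := e.summable_iff.2 hs
  rw [conv_conv_eq_tsum ha hb hc, ← e.tsum_eq]
  have h2 := Summable.tsum_prod hs'
  simp only [Function.comp_apply] at h2
  rw [h2, conv]
  refine tsum_congr fun l => ?_
  rw [conv, ← tsum_mul_left]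
  refine tsum_congr fun j => ?_
  simp only [e, Equiv.coe_fn_mk]
  congr 2
  abel

lemma conv_const_mul (x : ℂ) : conv a (fun n => x * b n) = fun n => x * conv a b n := by
  ext n
  rw [conv, conv, ← tsum_mul_left]
  exact tsum_congr fun l => by ring

lemma conv_shift (l n : Fin 2 → ℤ) : conv (fun n => a (n - l)) b n = conv a b (n - l) := by
  rw [conv, conv]
  exact tsum_congr fun j => by rw [sub_right_comm]

lemma decay_chr_neg (z : ℂ) : Decay 0 fun n => chr (-n) z := decay_zero_iff.2 ⟨1, fun n => by simp⟩

/-- Up to normalisation, `n ↦ chr (-n) z` is the coefficient sequence of the Dirac mass at `z`;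
multiplying it by a function evaluates the function at `z`. -/
lemma conv_chr_neg (z : ℂ) (n : Fin 2 → ℤ) :
    conv (fun n => chr (-n) z) a n = chr (-n) z * series a z := by
  rw [conv, series, ← tsum_mul_left]
  refine tsum_congr fun l => ?_
  rw [neg_sub, sub_eq_add_neg, add_comm, chr_add_left]
  ring

/-- Associativity of convolution, applied to the Dirac sequence at `z` and read at index `0`. -/
lemma series_conv (ha : Summable fun n => ‖a n‖) (hb : Summable fun n => ‖b n‖) (z : ℂ) :
    series (conv a b) z = series a z * series b z := by
  have h := congrFun (conv_assoc (decay_chr_neg z) ha hb) 0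
  rw [conv_chr_neg, conv] at h
  simp only [conv_chr_neg] at h
  simp only [neg_zero, chr_zero_left, one_mul] at h
  rw [← h, mul_comm, show series b z = ∑' n, b n * chr n z from rfl, ← tsum_mul_right]
  simp only [zero_sub, neg_neg]
  exact (tsum_congr fun l => by ring)

/-- The Leibniz rule in Fourier space, with the shift `k` carried by the first factor; it comes from
`κₙ = κₙ₋ₗ + κₗ` inside the sum. -/
lemma dualPt_mul_conv (ha : Decay 0 a) (ha' : Decay 0 fun n => (dualPt n + k) * a n)
    (hb : Summable fun n => ‖b n‖) (hb' : Summable fun n => ‖dualPt n * b n‖) (n : Fin 2 → ℤ) :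
    (dualPt n + k) * conv a b n =
      conv (fun n => (dualPt n + k) * a n) b n + conv a (fun n => dualPt n * b n) n := by
  have h1 := (summable_norm_conv ha' hb n).of_norm
  have h2 := (summable_norm_conv ha hb' n).of_norm
  rw [conv, conv, conv, ← h1.tsum_add h2, ← tsum_mul_left]
  refine tsum_congr fun l => ?_
  rw [dualPt_sub]
  ring

/-! ### Fourier series -/

lemma summable_series (ha : Summable fun n => ‖a n‖) (z : ℂ) :
    Summable fun n => a n * chr n z := by
  refine Summable.of_norm ?_
  simpa using ha

lemma isLatticePeriodic_series : IsLatticePeriodic (series a) := fun γ hγ z => by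
  simp only [series, isLatticePeriodic_chr _ γ hγ z]

lemma continuous_series (ha : Summable fun n => ‖a n‖) : Continuous (series a) :=
  continuous_tsum (fun n => continuous_const.mul (continuous_chr n)) ha fun n z => by simp

lemma norm_phase_le (κ : ℂ) : ‖phase κ‖ ≤ 2 * ‖κ‖ := by
  refine ContinuousLinearMap.opNorm_le_bound _ (by positivity) fun z => ?_
  rw [phase_apply]
  have h1 := mul_le_mul (abs_re_le_norm κ) (abs_re_le_norm z) (abs_nonneg _) (norm_nonneg _)
  have h2 := mul_le_mul (abs_im_le_norm κ) (abs_im_le_norm z) (abs_nonneg _) (norm_nonneg _)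
  rw [← abs_mul] at h1 h2
  rw [Real.norm_eq_abs]
  linarith [abs_add_le (κ.re * z.re) (κ.im * z.im)]

/-- Termwise differentiation of a Fourier series. -/
lemma hasFDerivAt_series (ha : Summable fun n => weight n * ‖a n‖) (z : ℂ) :
    HasFDerivAt (series a)
      (∑' n, (a n * (chr n z * I)) • (ofRealCLM.comp (phase (dualPt n)))) z ∧
    Summable fun n => (a n * (chr n z * I)) • (ofRealCLM.comp (phase (dualPt n))) := by
  have hb : ∀ n z, ‖(a n * (chr n z * I)) • (ofRealCLM.comp (phase (dualPt n)))‖ ≤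
      2 * (weight n * ‖a n‖) := by
    intro n z
    rw [norm_smul, norm_mul, norm_mul, norm_chr, norm_I, mul_one, mul_one]
    have h1 : ‖ofRealCLM.comp (phase (dualPt n))‖ ≤ 1 * (2 * ‖dualPt n‖) :=
      (ContinuousLinearMap.opNorm_comp_le _ _).trans
        (mul_le_mul (by simp) (norm_phase_le _) (norm_nonneg _) zero_le_one)
    have := norm_dualPt_le_weight n
    nlinarith [norm_nonneg (a n)]
  have ha' : Summable fun n => ‖a n‖ := ha.of_nonneg_of_le (fun _ => norm_nonneg _)
    fun n => by nlinarith [norm_nonneg (a n), one_le_weight n]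
  refine ⟨hasFDerivAt_tsum (ha.mul_left 2) (fun n x => ?_) hb (summable_series ha' 0) z,
    (ha.mul_left 2).of_norm_bounded fun n => hb n z⟩
  rw [mul_smul]
  exact (hasFDerivAt_planeWave (dualPt n) x).const_mul (a n)

lemma fderiv_series_apply (ha : Summable fun n => weight n * ‖a n‖) (z e : ℂ) :
    fderiv ℝ (series a) z e = series (fun n => I * (phase (dualPt n) e : ℝ) * a n) z := by
  obtain ⟨h1, h2⟩ := hasFDerivAt_series ha z
  rw [h1.fderiv, ← ContinuousLinearMap.apply_apply (𝕜 := ℝ) e (∑' n, _),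
    (ContinuousLinearMap.apply ℝ ℂ e).map_tsum h2, series]
  refine tsum_congr fun n => ?_
  simp
  ring

lemma differentiable_series (ha : Summable fun n => weight n * ‖a n‖) :
    Differentiable ℝ (series a) := fun z => (hasFDerivAt_series ha z).1.differentiableAt

lemma Rapid.phase_mul (ha : Rapid a) (e : ℂ) :
    Rapid fun n => I * (phase (dualPt n) e : ℝ) * a n := by
  have h : ∀ n, ‖((phase (dualPt n) e : ℝ) : ℂ)‖ ≤ 2 * ‖e‖ * ‖dualPt n‖ := fun n => by
    rw [norm_real]
    refine ((phase (dualPt n)).le_opNorm e).trans ?_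
    nlinarith [norm_phase_le (dualPt n), norm_nonneg e]
  intro m
  obtain ⟨C, hC⟩ := ha (m + 1)
  refine ⟨2 * ‖e‖ * C, fun n => ?_⟩
  have := weight_pos n
  calc weight n ^ m * ‖I * (phase (dualPt n) e : ℝ) * a n‖
      ≤ weight n ^ m * ((2 * ‖e‖ * weight n) * ‖a n‖) := by
        rw [norm_mul, norm_mul, norm_I, one_mul]
        gcongr
        refine (h n).trans ?_
        gcongr
        exact norm_dualPt_le_weight n
    _ = 2 * ‖e‖ * (weight n ^ (m + 1) * ‖a n‖) := by ring
    _ ≤ 2 * ‖e‖ * C := by gcongr; exact hC n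

lemma Rapid.summable_weight (ha : Rapid a) : Summable fun n => weight n * ‖a n‖ := by
  simpa using (ha 4).summable_weight (m := 1)

lemma twoDbar_series (ha : Summable fun n => weight n * ‖a n‖) (z : ℂ) :
    twoDbar (series a) z = series (fun n => dualPt n * a n) z := by
  have ha' : ∀ e, Summable fun n => I * (phase (dualPt n) e : ℝ) * a n * chr n z := by
    intro e
    refine (ha.mul_left (2 * ‖e‖)).of_norm_bounded fun n => ?_
    rw [norm_mul, norm_mul, norm_mul, norm_I, norm_chr, norm_real]
    have h1 := (phase (dualPt n)).le_opNorm e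
    have h2 := norm_phase_le (dualPt n)
    have h3 := norm_dualPt_le_weight n
    have : ‖phase (dualPt n) e‖ ≤ 2 * ‖e‖ * weight n := by
      nlinarith [norm_nonneg e]
    nlinarith [norm_nonneg (a n)]
  rw [twoDbar, fderiv_series_apply ha, fderiv_series_apply ha]
  simp only [series]
  rw [← tsum_mul_left (a := I), ← (ha' 1).tsum_add ((ha' I).mul_left I), ← tsum_mul_left]
  refine tsum_congr fun n => ?_
  simp only [phase_apply, one_re, one_im, I_re, I_im, mul_one, mul_zero, add_zero, zero_add,
    one_div, inv_I]
  linear_combination (-a n * chr n z * (dualPt n).re - a n * chr n z * (dualPt n).im * I) * I_sq +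
    a n * chr n z * re_add_im (dualPt n)

lemma contDiff_series (ha : Rapid a) : ContDiff ℝ (⊤ : ℕ∞) (series a) := by
  rw [contDiff_infty]
  intro m
  induction m generalizing a with
  | zero => exact contDiff_zero.2 (continuous_series ha.summable)
  | succ m ih =>
    have h : fderiv ℝ (series a) = fun z =>
        reCLM.smulRight (series (fun n => I * (phase (dualPt n) 1 : ℝ) * a n) z) +
        imCLM.smulRight (series (fun n => I * (phase (dualPt n) I : ℝ) * a n) z) := by
      ext z e
      conv_lhs => rw [← re_add_im e]
      rw [show (e.re : ℂ) + e.im * I = e.re • (1 : ℂ) + e.im • I by simp, map_add, map_smul,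
        map_smul, fderiv_series_apply ha.summable_weight, fderiv_series_apply ha.summable_weight]
      simp
    push_cast
    rw [contDiff_succ_iff_fderiv]
    refine ⟨differentiable_series ha.summable_weight, by simp, ?_⟩
    rw [h]
    have h1 := ih (ha.phase_mul 1)
    have h2 := ih (ha.phase_mul I)
    exact (contDiff_const.smulRight h1).add (contDiff_const.smulRight h2)

end Sequences

section Cell

open Pointwise

/-! ### The fundamental cell -/

/-- The coordinates `(s, t)` of `s + t ω`. -/
def latticeCoord : (Fin 2 → ℝ) ≃ₗ[ℝ] ℂ where
  toFun x := x 0 + x 1 * omega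
  invFun z := ![z.re + z.im / √3, 2 * z.im / √3]
  map_add' x y := by simp; ring
  map_smul' r x := by simp; ring
  left_inv x := by
    have h3 : √3 ≠ 0 := by positivity
    ext i
    fin_cases i
    · simp [omega_eq]; field_simp; ring
    · simp [omega_eq]; field_simp
  right_inv z := by
    have h3 : √3 ≠ 0 := by positivity
    apply Complex.ext
    · simp [omega_eq]; field_simp; ring
    · simp [omega_eq]; field_simp

lemma latticeCoord_apply (x : Fin 2 → ℝ) : latticeCoord x = x 0 + x 1 * omega := rfl

/-- The basis `(1, ω)` of `ℂ`. -/
def latticeBasis : Module.Basis (Fin 2) ℝ ℂ := Module.Basis.ofEquivFun latticeCoord.symm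

lemma cell_eq_image : cell = latticeCoord '' {x | ∀ i, x i ∈ Set.Ico (0 : ℝ) 1} := by
  ext z
  constructor
  · rintro ⟨s, hs, t, ht, rfl⟩
    exact ⟨![s, t], fun i => by fin_cases i <;> assumption, by simp [latticeCoord_apply]⟩
  · rintro ⟨x, hx, rfl⟩
    exact ⟨x 0, hx 0, x 1, hx 1, rfl⟩

lemma cell_eq_fundamentalDomain : cell = ZSpan.fundamentalDomain latticeBasis := by
  rw [cell_eq_image]
  ext z
  simp only [Set.mem_image, Set.mem_ofPred_eq, ZSpan.mem_fundamentalDomain]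
  constructor
  · rintro ⟨x, hx, rfl⟩ i
    simpa [latticeBasis, Module.Basis.ofEquivFun_repr_apply] using hx i
  · intro h
    refine ⟨latticeCoord.symm z, fun i => ?_, latticeCoord.apply_symm_apply z⟩
    simpa [latticeBasis, Module.Basis.ofEquivFun_repr_apply] using h i

lemma latticeBasis_zero : latticeBasis 0 = 1 := by
  simp [latticeBasis, latticeCoord_apply]

lemma latticeBasis_one : latticeBasis 1 = omega := by
  simp [latticeBasis, latticeCoord_apply]

lemma mem_lattice_of_mem_span {γ : ℂ} (h : γ ∈ Submodule.span ℤ (Set.range latticeBasis)) :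
    γ ∈ lattice := by
  rw [Submodule.mem_span_range_iff_exists_fun] at h
  obtain ⟨c, rfl⟩ := h
  exact ⟨c 1, c 0, by simp [Fin.sum_univ_two, latticeBasis_zero, latticeBasis_one]; ring⟩

instance countable_latticeSubgroup :
    Countable (Submodule.span ℤ (Set.range latticeBasis)).toAddSubgroup :=
  inferInstanceAs (Countable (Submodule.span ℤ (Set.range latticeBasis)))

lemma isAddFundamentalDomain_cell :
    IsAddFundamentalDomain (Submodule.span ℤ (Set.range latticeBasis)).toAddSubgroup cell volume := by
  rw [cell_eq_fundamentalDomain]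
  exact ZSpan.isAddFundamentalDomain' latticeBasis volume

lemma measurableSet_cell : MeasurableSet cell := by
  rw [cell_eq_fundamentalDomain]
  exact ZSpan.fundamentalDomain_measurableSet latticeBasis

lemma isBounded_cell : Bornology.IsBounded cell := by
  rw [cell_eq_fundamentalDomain]
  exact ZSpan.fundamentalDomain_isBounded latticeBasis

instance isFiniteMeasure_restrict_cell : IsFiniteMeasure (volume.restrict cell) :=
  ⟨by rw [Measure.restrict_apply_univ]; exact isBounded_cell.measure_lt_top⟩

lemma IsLatticePeriodic.vadd_eq {G : ℂ → ℂ} (hG : IsLatticePeriodic G)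
    (g : (Submodule.span ℤ (Set.range latticeBasis)).toAddSubgroup) (z : ℂ) : G (g +ᵥ z) = G z := by
  rw [AddSubgroup.vadd_def, vadd_eq_add, add_comm]
  exact hG _ (mem_lattice_of_mem_span g.2) z

lemma isAddFundamentalDomain_vadd_cell (w : ℂ) :
    IsAddFundamentalDomain (Submodule.span ℤ (Set.range latticeBasis)).toAddSubgroup
      (w +ᵥ cell) volume :=
  isAddFundamentalDomain_cell.vadd_of_comm w

lemma preimage_vadd_cell (w : ℂ) : (fun z => z + w) ⁻¹' (w +ᵥ cell) = cell := by
  ext z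
  simp [Set.mem_vadd_set_iff_neg_vadd_mem, add_comm]

/-- Integrals of periodic functions over the cell are invariant under translations. -/
lemma setIntegral_cell_add {G : ℂ → ℂ} (hG : IsLatticePeriodic G) (w : ℂ) :
    ∫ z in cell, G (z + w) = ∫ z in cell, G z := by
  have h := isAddFundamentalDomain_cell.setIntegral_eq (isAddFundamentalDomain_vadd_cell w)
    (f := G) hG.vadd_eq
  have h2 := (measurePreserving_add_right volume w).setIntegral_preimage_emb
    (MeasurableEquiv.addRight w).measurableEmbedding G (w +ᵥ cell)
  rw [preimage_vadd_cell] at h2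
  rw [h, h2]

lemma setIntegral_norm_cell_add {G : ℂ → ℂ} (hG : IsLatticePeriodic G) (w : ℂ) :
    ∫ z in cell, ‖G (z + w)‖ = ∫ z in cell, ‖G z‖ := by
  have h := isAddFundamentalDomain_cell.setIntegral_eq (isAddFundamentalDomain_vadd_cell w)
    (f := fun z => ‖G z‖) (fun g z => by rw [hG.vadd_eq])
  have h2 := (measurePreserving_add_right volume w).setIntegral_preimage_emb
    (MeasurableEquiv.addRight w).measurableEmbedding (fun z => ‖G z‖) (w +ᵥ cell)
  rw [preimage_vadd_cell] at h2
  rw [h, h2]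

lemma integrableOn_cell_add {G : ℂ → ℂ} (hG : IsLatticePeriodic G) (hi : IntegrableOn G cell)
    (w : ℂ) : IntegrableOn (fun z => G (z + w)) cell := by
  have h := (isAddFundamentalDomain_cell.integrableOn_iff (isAddFundamentalDomain_vadd_cell w)
    (f := G) hG.vadd_eq).1 hi
  have h2 := ((measurePreserving_add_right volume w).integrableOn_comp_preimage
    (MeasurableEquiv.addRight w).measurableEmbedding (f := G) (s := w +ᵥ cell)).2 h
  rwa [preimage_vadd_cell] at h2

/-- The set where the functions differ is invariant under the lattice, so it is null once its part
in a fundamental domain is. -/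
lemma ae_eq_of_ae_eq_cell {f g : ℂ → ℂ} (hf : IsLatticePeriodic f) (hg : IsLatticePeriodic g)
    (h : ∀ᵐ z ∂volume.restrict cell, f z = g z) : ∀ᵐ z, f z = g z := by
  rw [ae_restrict_iff' measurableSet_cell] at h
  rw [ae_iff]
  refine isAddFundamentalDomain_cell.measure_zero_of_invariant _ (fun γ => ?_) ?_
  · ext z
    rw [Set.mem_vadd_set_iff_neg_vadd_mem]
    simp only [Set.mem_ofPred_eq]
    rw [hf.vadd_eq, hg.vadd_eq]
  · rw [ae_iff] at h
    refine measure_mono_null (fun z hz => ?_) h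
    simp only [Set.mem_ofPred_eq, Classical.not_imp]
    exact ⟨hz.2, hz.1⟩

lemma IsLatticePeriodic.mul {f g : ℂ → ℂ} (hf : IsLatticePeriodic f) (hg : IsLatticePeriodic g) :
    IsLatticePeriodic fun z => f z * g z := fun γ hγ z => by simp only [hf γ hγ, hg γ hγ]

lemma exists_lattice_add_mem_cell (z : ℂ) : ∃ γ ∈ lattice, z + γ ∈ cell := by
  obtain ⟨v, hv, -⟩ := ZSpan.exist_unique_vadd_mem_fundamentalDomain latticeBasis z
  rw [← cell_eq_fundamentalDomain, Submodule.vadd_def, vadd_eq_add, add_comm] at hv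
  exact ⟨v, mem_lattice_of_mem_span v.2, hv⟩

lemma IsLatticePeriodic.bounded {f : ℂ → ℂ} (hf : IsLatticePeriodic f) (hc : Continuous f) :
    ∃ C, ∀ z, ‖f z‖ ≤ C := by
  obtain ⟨C, hC⟩ := (isBounded_cell.isCompact_closure).exists_bound_of_continuousOn
    hc.continuousOn
  refine ⟨C, fun z => ?_⟩
  obtain ⟨γ, hγ, hz⟩ := exists_lattice_add_mem_cell z
  rw [← hf γ hγ z]
  exact hC _ (subset_closure hz)

lemma IsLatticePeriodic.memLp {f : ℂ → ℂ} (hf : IsLatticePeriodic f) (hc : Continuous f) :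
    MemLp f 2 (volume.restrict cell) := by
  obtain ⟨C, hC⟩ := hf.bounded hc
  exact MemLp.of_bound hc.aestronglyMeasurable C (Filter.Eventually.of_forall hC)

lemma IsLatticePeriodic.memL2 {f : ℂ → ℂ} (hf : IsLatticePeriodic f) (hc : Continuous f) :
    MemL2 f := ⟨hf, hf.memLp hc⟩

lemma MemL2.integrableOn {f : ℂ → ℂ} (hf : MemL2 f) : IntegrableOn f cell :=
  hf.2.integrable (by norm_num)

/-! ### Completeness of the characters -/

section Torus

local instance : MeasureSpace UnitAddCircle := ⟨AddCircle.haarAddCircle⟩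

local instance : Measure.IsAddHaarMeasure (volume : Measure UnitAddCircle) :=
  inferInstanceAs (Measure.IsAddHaarMeasure AddCircle.haarAddCircle)

/-- The half-open unit square. -/
def unitBox : Set (Fin 2 → ℝ) := {x | ∀ i, x i ∈ Set.Ioc (0 : ℝ) 1}

lemma measurableSet_unitBox : MeasurableSet unitBox :=
  MeasurableSet.univ_pi' (fun _ => measurableSet_Ioc)

/-- The section of `ℂ → ℂ/Λ` with values in the closure of the cell. -/
def torusSection (x : UnitAddTorus (Fin 2)) : ℂ :=
  latticeCoord (UnitAddTorus.measurableEquivPiIoc 0 x).1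

lemma measurable_latticeCoord : Measurable latticeCoord :=
  (LinearMap.continuous_of_finiteDimensional (latticeCoord : (Fin 2 → ℝ) →ₗ[ℝ] ℂ)).measurable

/-- Uniqueness of Haar measure gives the constant without computing a Jacobian; its nonvanishing is
all that is needed to transport null sets. The boxes built from `Ioc` and `Ico` differ by a null
set. -/
lemma exists_map_latticeCoord : ∃ c : NNReal, c ≠ 0 ∧
    Measure.map latticeCoord (volume.restrict unitBox) = c • volume.restrict cell := by
  let L : (Fin 2 → ℝ) ≃L[ℝ] ℂ := latticeCoord.toContinuousLinearEquiv
  have hL : ⇑L = latticeCoord := rfl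
  have : (Measure.map L (volume : Measure (Fin 2 → ℝ))).IsAddHaarMeasure :=
    L.isAddHaarMeasure_map volume
  refine ⟨Measure.addHaarScalarFactor (Measure.map L volume) volume,
    (Measure.addHaarScalarFactor_pos_of_isAddHaarMeasure _ _).ne', ?_⟩
  have h1 := Measure.isAddLeftInvariant_eq_smul (Measure.map L volume) volume
  have hbox : (volume.restrict unitBox : Measure (Fin 2 → ℝ)) = volume.restrict (L ⁻¹' cell) := by
    have : L ⁻¹' cell = {x | ∀ i, x i ∈ Set.Ico (0 : ℝ) 1} := by
      rw [cell_eq_image, ← hL, Set.preimage_image_eq _ L.injective]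
    rw [this]
    refine Measure.restrict_congr_set ?_
    have e1 : unitBox = Set.pi Set.univ fun _ => Set.Ioc (0 : ℝ) 1 := by
      ext; simp [unitBox]
    have e2 : {x : Fin 2 → ℝ | ∀ i, x i ∈ Set.Ico (0 : ℝ) 1} =
        Set.pi Set.univ fun _ => Set.Ico (0 : ℝ) 1 := by
      ext; simp
    rw [e1, e2]
    exact Measure.univ_pi_Ioc_ae_eq_Icc.trans Measure.univ_pi_Ico_ae_eq_Icc.symm
  rw [hbox, ← hL, ← Measure.restrict_map L.continuous.measurable measurableSet_cell]
  conv_lhs => rw [h1]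
  rw [Measure.restrict_smul]

lemma measurePreserving_coe_unitBox : MeasurePreserving
    (fun (x : Fin 2 → ℝ) => (fun i => x i : UnitAddTorus (Fin 2))) (volume.restrict unitBox)
    volume := by
  have h1 : MeasurePreserving (fun y : ℝ => (y : UnitAddCircle))
      (volume.restrict (Set.Ioc (0 : ℝ) 1)) volume := by
    have h := AddCircle.measurePreserving_mk 1 0
    rw [zero_add, AddCircle.volume_eq_smul_haarAddCircle, ENNReal.ofReal_one, one_smul] at h
    exact h
  have h2 := measurePreserving_pi _ _ (fun _ : Fin 2 => h1)
  rw [← Measure.restrict_pi_pi] at h2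
  have e1 : unitBox = Set.pi Set.univ fun _ => Set.Ioc (0 : ℝ) 1 := by
    ext; simp [unitBox]
  rw [e1]
  exact h2

lemma torusSection_coe {x : Fin 2 → ℝ} (hx : x ∈ unitBox) :
    torusSection (fun i => (x i : UnitAddCircle)) = latticeCoord x := by
  have hx' : ∀ i, x i ∈ Set.Ioc ((0 : Fin 2 → ℝ) i) ((0 : Fin 2 → ℝ) i + 1) := by
    simpa [unitBox] using hx
  have := (UnitAddTorus.measurableEquivPiIoc (0 : Fin 2 → ℝ)).apply_symm_apply ⟨x, hx'⟩
  rw [UnitAddTorus.coe_symm_measurableEquivPiIoc_apply] at this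
  rw [torusSection, this]

lemma measurable_torusSection : Measurable torusSection :=
  measurable_latticeCoord.comp (measurable_subtype_coe.comp (MeasurableEquiv.measurable _))

lemma exists_map_torusSection : ∃ c : NNReal, c ≠ 0 ∧
    Measure.map torusSection volume = c • volume.restrict cell := by
  obtain ⟨c, hc, h⟩ := exists_map_latticeCoord
  refine ⟨c, hc, ?_⟩
  rw [← h, ← measurePreserving_coe_unitBox.map_eq,
    Measure.map_map measurable_torusSection measurePreserving_coe_unitBox.measurable]
  refine Measure.map_congr ?_
  filter_upwards [ae_restrict_mem measurableSet_unitBox] with x hx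
  exact torusSection_coe hx

lemma chr_torusSection (n : Fin 2 → ℤ) (x : UnitAddTorus (Fin 2)) :
    chr n (torusSection x) = UnitAddTorus.mFourier n x := by
  obtain ⟨y, rfl⟩ := (UnitAddTorus.measurableEquivPiIoc (0 : Fin 2 → ℝ)).symm.surjective x
  rw [torusSection, MeasurableEquiv.apply_symm_apply, latticeCoord_apply, chr_apply]
  simp only [UnitAddTorus.coe_symm_measurableEquivPiIoc_apply, UnitAddTorus.mFourier,
    ContinuousMap.coe_mk, Fin.prod_univ_two, fourier_coe_apply]
  rw [← Complex.exp_add]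
  congr 1
  push_cast
  ring

/-- An `L²` function on the cell whose Fourier coefficients vanish is zero. -/
lemma ae_eq_zero_of_integral_mul_chr_eq_zero {f : ℂ → ℂ} (hf : MemLp f 2 (volume.restrict cell))
    (h : ∀ n, ∫ z in cell, f z * chr n z = 0) : ∀ᵐ z ∂volume.restrict cell, f z = 0 := by
  obtain ⟨c, hc, hmap⟩ := exists_map_torusSection
  have hf' : MemLp f 2 (Measure.map torusSection volume) := by
    rw [hmap]; exact hf.smul_measure ENNReal.coe_ne_top
  have hF : MemLp (f ∘ torusSection) 2 volume := hf'.comp_of_map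
    measurable_torusSection.aemeasurable
  have hcoef : ∀ n, UnitAddTorus.mFourierCoeff (f ∘ torusSection) n = 0 := by
    intro n
    have h1 : ∫ x, (fun z => f z * chr (-n) z) (torusSection x) =
        ∫ z, f z * chr (-n) z ∂(Measure.map torusSection volume) :=
      (integral_map measurable_torusSection.aemeasurable
        (hf'.1.mul (continuous_chr _).aestronglyMeasurable)).symm
    rw [hmap, integral_smul_nnreal_measure, h, smul_zero] at h1
    rw [UnitAddTorus.mFourierCoeff, ← h1]
    refine integral_congr_ae (Filter.Eventually.of_forall fun x => ?_)
    simp only [Function.comp_apply, smul_eq_mul, chr_torusSection]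
    ring
  have hzero : hF.toLp _ = 0 := by
    refine (UnitAddTorus.mFourierBasis (d := Fin 2)).repr.injective ?_
    rw [map_zero]
    ext n
    rw [UnitAddTorus.mFourierBasis_repr]
    have : UnitAddTorus.mFourierCoeff (hF.toLp _) n =
        UnitAddTorus.mFourierCoeff (f ∘ torusSection) n := by
      refine integral_congr_ae ?_
      filter_upwards [hF.coeFn_toLp] with x hx
      simp only [hx]
    rw [this, hcoef]
    simp
  have h2 : ∀ᵐ x, (f ∘ torusSection) x = 0 := by
    have := hF.coeFn_toLp
    rw [hzero] at this
    filter_upwards [this, Lp.coeFn_zero ℂ 2 (volume : Measure (UnitAddTorus (Fin 2)))] with x h1 h2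
    rw [← h1, h2]
    rfl
  have h3 : ∀ᵐ z ∂(Measure.map torusSection volume), f z = 0 := by
    have hmk := hf'.1.ae_eq_mk
    -- A strongly measurable representative is used because pulling an almost everywhere statement
    -- back through a map requires a measurable zero set.
    have h4 : ∀ᵐ z ∂(Measure.map torusSection volume), hf'.1.mk f z = 0 := by
      refine (ae_map_iff measurable_torusSection.aemeasurable
        (hf'.1.stronglyMeasurable_mk.measurable (measurableSet_singleton 0))).2 ?_
      filter_upwards [h2, ae_of_ae_map measurable_torusSection.aemeasurable hmk] with x h5 h6
      rw [← h6]
      exact h5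
    filter_upwards [hmk, h4] with z h5 h6
    rw [h5, h6]
  rw [hmap, Measure.ae_smul_measure_iff (by simpa using hc)] at h3
  exact h3

end Torus

end Cell

/-! ### Fourier coefficients -/

/-- The area of the cell. -/
def cellArea : ℝ := volume.real cell

lemma cellArea_pos : 0 < cellArea := by
  refine ENNReal.toReal_pos ?_ isBounded_cell.measure_lt_top.ne
  rw [cell_eq_fundamentalDomain]
  exact ZSpan.measure_fundamentalDomain_ne_zero latticeBasis

lemma cellArea_ne_zero : (cellArea : ℂ) ≠ 0 := by exact_mod_cast cellArea_pos.ne'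

/-- The Fourier coefficients of a function on `ℂ/Λ`. -/
def coeff (f : ℂ → ℂ) (n : Fin 2 → ℤ) : ℂ := (cellArea : ℂ)⁻¹ * ∫ z in cell, f z * chr (-n) z

lemma integrableOn_mul_chr {f : ℂ → ℂ} (hf : IntegrableOn f cell) (n : Fin 2 → ℤ) :
    IntegrableOn (fun z => f z * chr n z) cell :=
  Integrable.mul_bdd (c := 1) hf (continuous_chr n).aestronglyMeasurable
    (Filter.Eventually.of_forall fun z => by simp)

lemma decay_coeff (f : ℂ → ℂ) : Decay 0 (coeff f) := by
  refine decay_zero_iff.2 ⟨‖(cellArea : ℂ)⁻¹‖ * ∫ z in cell, ‖f z‖, fun n => ?_⟩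
  rw [coeff, norm_mul]
  gcongr
  refine (norm_integral_le_integral_norm _).trans_eq ?_
  simp

lemma exists_chr_ne_one {n : Fin 2 → ℤ} (hn : n ≠ 0) : ∃ w, chr n w ≠ 1 := by
  have key : ∀ x : ℂ, x = Real.pi * I → exp x ≠ 1 := by
    rintro x rfl
    rw [exp_pi_mul_I]
    norm_num
  by_cases h0 : n 0 = 0
  · have h1 : (n 1 : ℂ) ≠ 0 := by
      intro h
      refine hn (funext fun i => ?_)
      fin_cases i
      · exact h0
      · exact_mod_cast h
    refine ⟨((0 : ℝ) : ℂ) + ((1 / (2 * n 1) : ℝ) : ℂ) * omega, ?_⟩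
    rw [chr_apply]
    apply key
    push_cast
    field_simp
    simp [h0]
  · have h1 : (n 0 : ℂ) ≠ 0 := by exact_mod_cast h0
    refine ⟨((1 / (2 * n 0) : ℝ) : ℂ) + ((0 : ℝ) : ℂ) * omega, ?_⟩
    rw [chr_apply]
    apply key
    push_cast
    field_simp
    simp

/-- Translating by `w` leaves the integral unchanged but multiplies it by `chr n w`, which is not
`1` for a suitable `w`. -/
lemma integral_chr {n : Fin 2 → ℤ} (hn : n ≠ 0) : ∫ z in cell, chr n z = 0 := by
  obtain ⟨w, hw⟩ := exists_chr_ne_one hn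
  have h := setIntegral_cell_add (isLatticePeriodic_chr n) w
  simp only [chr_add_right] at h
  rw [integral_mul_const] at h
  have h2 : (∫ z in cell, chr n z) * (chr n w - 1) = 0 := by linear_combination h
  exact (mul_eq_zero.1 h2).resolve_right (sub_ne_zero.2 hw)

lemma coeff_one (n : Fin 2 → ℤ) : coeff (fun _ => 1) n = if n = 0 then 1 else 0 := by
  rw [coeff]
  split_ifs with h
  · subst h
    have : ∫ z in cell, (1 : ℂ) = cellArea := by simp [cellArea]
    simp only [neg_zero, chr_zero_left, mul_one, this]
    exact inv_mul_cancel₀ cellArea_ne_zero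
  · simp only [one_mul]
    rw [integral_chr (neg_ne_zero.2 h), mul_zero]

/-- The Fourier coefficients of a product with an absolutely convergent Fourier series. -/
lemma coeff_mul_series {f : ℂ → ℂ} (hf : IntegrableOn f cell) {b : (Fin 2 → ℤ) → ℂ}
    (hb : Summable fun n => ‖b n‖) (n : Fin 2 → ℤ) :
    coeff (fun z => f z * series b z) n = conv (coeff f) b n := by
  have hint : ∀ m, Integrable (fun z => b m * (f z * chr (m - n) z)) (volume.restrict cell) :=
    fun m => (integrableOn_mul_chr hf _).const_mul (b m)
  have hsum : Summable fun m => ∫ z in cell, ‖b m * (f z * chr (m - n) z)‖ := by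
    simp only [norm_mul, norm_chr, mul_one]
    simp only [integral_const_mul]
    exact hb.mul_right _
  have h := (hasSum_integral_of_summable_integral_norm hint hsum).tsum_eq
  have e : ∀ z, ∑' m, b m * (f z * chr (m - n) z) = f z * series b z * chr (-n) z := by
    intro z
    rw [series, ← tsum_mul_left, ← tsum_mul_right]
    refine tsum_congr fun m => ?_
    rw [sub_eq_add_neg, chr_add_left]
    ring
  simp only [e] at h
  rw [coeff, ← h, conv, ← tsum_mul_left]
  refine tsum_congr fun m => ?_
  rw [integral_const_mul, coeff, neg_sub]
  ring

lemma coeff_series {a : (Fin 2 → ℤ) → ℂ} (ha : Summable fun n => ‖a n‖) :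
    coeff (series a) = a := by
  ext n
  have h := coeff_mul_series (f := fun _ => 1) (integrableOn_const isBounded_cell.measure_lt_top.ne)
    ha n
  simp only [one_mul] at h
  rw [h, conv, tsum_eq_single n]
  · simp [coeff_one]
  · intro m hm
    rw [coeff_one, if_neg (sub_ne_zero.2 hm.symm), zero_mul]

lemma series_injective {a : (Fin 2 → ℤ) → ℂ} (ha : Summable fun n => ‖a n‖)
    (h : ∀ z, series a z = 0) : a = 0 := by
  rw [← coeff_series ha]
  ext n
  simp [coeff, h]

/-- Periodic `L²` functions with equal Fourier coefficients agree almost everywhere. -/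
lemma ae_eq_of_coeff_eq {f g : ℂ → ℂ} (hf : MemL2 f) (hg : MemL2 g) (h : coeff f = coeff g) :
    ∀ᵐ z, f z = g z := by
  refine ae_eq_of_ae_eq_cell hf.1 hg.1 ?_
  have h2 := ae_eq_zero_of_integral_mul_chr_eq_zero (hf.2.sub hg.2) fun n => by
    have hn := congrFun h (-n)
    rw [coeff, coeff, neg_neg] at hn
    have hn' := mul_left_cancel₀ (inv_ne_zero cellArea_ne_zero) hn
    simp only [Pi.sub_apply, sub_mul]
    rw [integral_sub (integrableOn_mul_chr hf.integrableOn n)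
      (integrableOn_mul_chr hg.integrableOn n), hn', sub_self]
  filter_upwards [h2] with z hz
  exact sub_eq_zero.1 hz

lemma eq_of_coeff_eq {f g : ℂ → ℂ} (hf : IsLatticePeriodic f) (hf' : Continuous f)
    (hg : IsLatticePeriodic g) (hg' : Continuous g) (h : coeff f = coeff g) : f = g :=
  Measure.eq_of_ae_eq (ae_eq_of_coeff_eq (hf.memL2 hf') (hg.memL2 hg') h) hf' hg'

/-! ### Averaging over translations -/

/-- Averaging over the cell the integrals of a periodic function against the translates of a
compactly supported function. -/
lemma integral_cell_integral_translate {G φ : ℂ → ℂ} (hG : IsLatticePeriodic G)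
    (hGm : AEStronglyMeasurable G) (hGi : IntegrableOn G cell) (hφ : Continuous φ)
    (hφc : HasCompactSupport φ) :
    ∫ y in cell, ∫ z, G z * φ (z - y) = (∫ w, φ w) * ∫ z in cell, G z := by
  have h1 : ∀ y, ∫ z, G z * φ (z - y) = ∫ w, G (w + y) * φ w := fun y => by
    rw [← integral_add_right_eq_self (fun z => G z * φ (z - y)) y]
    simp
  simp only [h1]
  have hφi : Integrable φ := hφ.integrable_of_hasCompactSupport hφc
  have hint : Integrable (Function.uncurry fun (y w : ℂ) => G (w + y) * φ w)
      ((volume.restrict cell).prod volume) := by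
    have hm : AEStronglyMeasurable (Function.uncurry fun (y w : ℂ) => G (w + y) * φ w)
        ((volume.restrict cell).prod volume) := by
      refine AEStronglyMeasurable.mul ?_ (hφ.comp continuous_snd).aestronglyMeasurable
      have hq : Measure.QuasiMeasurePreserving (fun p : ℂ × ℂ => p.2 + p.1)
          ((volume.restrict cell).prod volume) volume := by
        have h2 : Measure.QuasiMeasurePreserving (fun p : ℂ × ℂ => p.2 + p.1)
            ((volume : Measure ℂ).prod volume) volume := by
          have := (quasiMeasurePreserving_add (volume : Measure ℂ) volume)
          simpa only [add_comm] using this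
        exact h2.mono_left (Measure.AbsolutelyContinuous.prod
          Measure.restrict_le_self.absolutelyContinuous Measure.AbsolutelyContinuous.rfl)
      exact hGm.comp_quasiMeasurePreserving hq
    rw [integrable_prod_iff' hm]
    constructor
    · refine Filter.Eventually.of_forall fun w => ?_
      have := (integrableOn_cell_add hG hGi w).mul_const (φ w)
      simpa only [Function.uncurry, add_comm] using this
    · have : (fun w => ∫ y in cell, ‖Function.uncurry (fun (y w : ℂ) => G (w + y) * φ w) (y, w)‖) =
          fun w => (∫ z in cell, ‖G z‖) * ‖φ w‖ := by
        ext w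
        simp only [Function.uncurry, norm_mul]
        rw [integral_mul_const, ← setIntegral_norm_cell_add hG w]
        simp only [add_comm]
      rw [this]
      exact hφi.norm.const_mul _
  -- After the exchange, the integral of `G (w + y)` over the cell in `y` no longer depends on `w`.
  rw [integral_integral_swap hint]
  have h2 : ∀ w, ∫ y in cell, G (w + y) * φ w = φ w * ∫ z in cell, G z := fun w => by
    rw [integral_mul_const, ← setIntegral_cell_add hG w, mul_comm]
    simp only [add_comm]
  simp only [h2]
  rw [integral_mul_const]

lemma integral_fderiv_of_hasCompactSupport {φ : ℂ → ℂ} (hφ : ContDiff ℝ 1 φ)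
    (hφc : HasCompactSupport φ) (e : ℂ) : ∫ z, fderiv ℝ φ z e = 0 := by
  have hc : Continuous fun z => fderiv ℝ φ z e :=
    (hφ.continuous_fderiv one_ne_zero).clm_apply continuous_const
  have hi : Integrable fun z => fderiv ℝ φ z e :=
    hc.integrable_of_hasCompactSupport (hφc.fderiv_apply ℝ e)
  have := integral_mul_fderiv_eq_neg_fderiv_mul_of_integrable (𝕜 := ℂ) (μ := volume)
    (f := fun _ : ℂ => (1 : ℂ)) (g := φ) (v := e) (by simp)
    (by simpa using hi) (by simpa using hφ.continuous.integrable_of_hasCompactSupport hφc)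
    (fun _ _ => differentiableAt_const _) (fun _ _ => hφ.differentiable one_ne_zero _)
  simpa using this

lemma integral_twoDbar_of_hasCompactSupport {φ : ℂ → ℂ} (hφ : ContDiff ℝ 1 φ)
    (hφc : HasCompactSupport φ) : ∫ z, twoDbar φ z = 0 := by
  have hi : ∀ e, Integrable fun z => fderiv ℝ φ z e := fun e =>
    ((hφ.continuous_fderiv one_ne_zero).clm_apply continuous_const).integrable_of_hasCompactSupport
      (hφc.fderiv_apply ℝ e)
  simp only [twoDbar]
  rw [integral_const_mul, integral_add (hi 1) ((hi I).const_mul I), integral_const_mul,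
    integral_fderiv_of_hasCompactSupport hφ hφc, integral_fderiv_of_hasCompactSupport hφ hφc]
  simp

/-! ### Weak derivatives -/

/-- The formal adjoint `k - 2D_{z̄}` of `2D_{z̄} + k`. -/
def adjDbar (k : ℂ) (φ : ℂ → ℂ) (z : ℂ) : ℂ := k * φ z - twoDbar φ z

lemma contDiff_fderiv_apply {f : ℂ → ℂ} (hf : ContDiff ℝ (⊤ : ℕ∞) f) (e : ℂ) :
    ContDiff ℝ (⊤ : ℕ∞) fun z => fderiv ℝ f z e :=
  (hf.fderiv_right (m := (⊤ : ℕ∞)) (by simp)).clm_apply contDiff_const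

lemma contDiff_twoDbar {f : ℂ → ℂ} (hf : ContDiff ℝ (⊤ : ℕ∞) f) :
    ContDiff ℝ (⊤ : ℕ∞) (twoDbar f) :=
  contDiff_const.mul ((contDiff_fderiv_apply hf 1).add
    (contDiff_const.mul (contDiff_fderiv_apply hf I)))

lemma differentiable_of_contDiff {f : ℂ → ℂ} (hf : ContDiff ℝ (⊤ : ℕ∞) f) :
    Differentiable ℝ f := hf.differentiable (by simp)

lemma contDiff_adjDbar {f : ℂ → ℂ} (k : ℂ) (hf : ContDiff ℝ (⊤ : ℕ∞) f) :
    ContDiff ℝ (⊤ : ℕ∞) (adjDbar k f) :=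
  (contDiff_const.mul hf).sub (contDiff_twoDbar hf)

lemma hasCompactSupport_twoDbar {f : ℂ → ℂ} (hf : HasCompactSupport f) :
    HasCompactSupport (twoDbar f) :=
  ((hf.fderiv_apply ℝ 1).add ((hf.fderiv_apply ℝ I).mul_left (f := fun _ => I))).mul_left
    (f := fun _ => 1 / I)

lemma hasCompactSupport_adjDbar {f : ℂ → ℂ} (k : ℂ) (hf : HasCompactSupport f) :
    HasCompactSupport (adjDbar k f) :=
  (hf.mul_left (f := fun _ => k)).sub (hasCompactSupport_twoDbar hf)

lemma integral_adjDbar {φ : ℂ → ℂ} (k : ℂ) (hφ : ContDiff ℝ (⊤ : ℕ∞) φ)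
    (hφc : HasCompactSupport φ) : ∫ z, adjDbar k φ z = k * ∫ z, φ z := by
  have h1 : Integrable (twoDbar φ) :=
    (contDiff_twoDbar hφ).continuous.integrable_of_hasCompactSupport (hasCompactSupport_twoDbar hφc)
  have h2 : Integrable φ := hφ.continuous.integrable_of_hasCompactSupport hφc
  simp only [adjDbar]
  rw [integral_sub (h2.const_mul k) h1, integral_const_mul,
    integral_twoDbar_of_hasCompactSupport (hφ.of_le (by simp)) hφc, sub_zero]

lemma twoDbar_comp_sub (φ : ℂ → ℂ) (y z : ℂ) :
    twoDbar (fun z => φ (z - y)) z = twoDbar φ (z - y) := by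
  simp only [twoDbar, fderiv_comp_sub]

lemma twoDbar_chr (n : Fin 2 → ℤ) (z : ℂ) : twoDbar (chr n) z = dualPt n * chr n z :=
  twoDbar_planeWave _ _

/-- Conjugation by a character moves the spectral parameter from `k` to `κₙ + k`. This is how the
factor `κₙ + k` reaches the Fourier coefficients. -/
lemma adjDbar_translate_mul_chr {φ : ℂ → ℂ} (hφ : Differentiable ℝ φ) (k y : ℂ)
    (n : Fin 2 → ℤ) :
    adjDbar k (fun z => φ (z - y) * chr (-n) z) =
      fun z => adjDbar (dualPt n + k) φ (z - y) * chr (-n) z := by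
  ext z
  have h : DifferentiableAt ℝ (fun z => φ (z - y)) z :=
    (hφ (z - y)).comp z (differentiableAt_id.sub_const y)
  rw [adjDbar, twoDbar_mul h ((contDiff_chr (-n) (m := 1)).differentiable (by simp) z),
    twoDbar_chr, twoDbar_comp_sub, adjDbar, dualPt_neg]
  ring

lemma iterate_adjDbar_translate_mul_chr {φ : ℂ → ℂ} (hφ : ContDiff ℝ (⊤ : ℕ∞) φ) (k y : ℂ)
    (n : Fin 2 → ℤ) (j : ℕ) :
    (adjDbar k)^[j] (fun z => φ (z - y) * chr (-n) z) =
      fun z => (adjDbar (dualPt n + k))^[j] φ (z - y) * chr (-n) z := by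
  induction j generalizing φ with
  | zero => rfl
  | succ j ih =>
    rw [Function.iterate_succ_apply, Function.iterate_succ_apply,
      adjDbar_translate_mul_chr (differentiable_of_contDiff hφ), ih (contDiff_adjDbar _ hφ)]

lemma iterate_adjDbar_spec {φ : ℂ → ℂ} (hφ : ContDiff ℝ (⊤ : ℕ∞) φ)
    (hφc : HasCompactSupport φ) (k : ℂ) (j : ℕ) :
    ContDiff ℝ (⊤ : ℕ∞) ((adjDbar k)^[j] φ) ∧ HasCompactSupport ((adjDbar k)^[j] φ) ∧
      ∫ z, (adjDbar k)^[j] φ z = k ^ j * ∫ z, φ z := by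
  induction j generalizing φ with
  | zero => exact ⟨hφ, hφc, by simp⟩
  | succ j ih =>
    obtain ⟨h1, h2, h3⟩ := ih (contDiff_adjDbar k hφ) (hasCompactSupport_adjDbar k hφc)
    refine ⟨h1, h2, ?_⟩
    rw [Function.iterate_succ_apply, h3, integral_adjDbar k hφ hφc]
    ring

/-- A smooth compactly supported function with nonzero integral. -/
lemma exists_test_function : ∃ φ : ℂ → ℂ, ContDiff ℝ (⊤ : ℕ∞) φ ∧ HasCompactSupport φ ∧
    ∫ z, φ z ≠ 0 := by
  let f : ContDiffBump (0 : ℂ) := ⟨1, 2, one_pos, one_lt_two⟩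
  refine ⟨fun z => (f z : ℂ), ofRealCLM.contDiff.comp f.contDiff,
    f.hasCompactSupport.comp_left (g := fun x : ℝ => (x : ℂ)) ofReal_zero, ?_⟩
  change (∫ z, ((f z : ℝ) : ℂ)) ≠ 0
  rw [integral_complex_ofReal]
  exact_mod_cast (f.integral_pos (μ := volume)).ne'

/-- A weak equation on `ℂ` between periodic functions gives the corresponding equation between
Fourier coefficients. -/
lemma coeff_of_weak {u h : ℂ → ℂ} {k : ℂ} (j : ℕ) (hu : IsLatticePeriodic u)
    (hum : AEStronglyMeasurable u) (hui : IntegrableOn u cell) (hh : IsLatticePeriodic h)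
    (hhm : AEStronglyMeasurable h) (hhi : IntegrableOn h cell)
    (H : ∀ φ : ℂ → ℂ, ContDiff ℝ (⊤ : ℕ∞) φ → HasCompactSupport φ →
      ∫ z, h z * φ z = ∫ z, u z * (adjDbar k)^[j] φ z) (n : Fin 2 → ℤ) :
    (dualPt n + k) ^ j * coeff u n = coeff h n := by
  obtain ⟨φ, hφ, hφc, hφ0⟩ := exists_test_function
  obtain ⟨h1, h2, h3⟩ := iterate_adjDbar_spec hφ hφc (dualPt n + k) j
  -- The equation is tested against translates of a bump times a character. Averaging over `y` in
  -- the cell then leaves cell integrals times `∫ φ` on one side and `(κₙ + k)ʲ ∫ φ` on the other.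
  have e : ∀ y, ∫ z, (h z * chr (-n) z) * φ (z - y) =
      ∫ z, (u z * chr (-n) z) * (adjDbar (dualPt n + k))^[j] φ (z - y) := by
    intro y
    have hc : HasCompactSupport fun z => φ (z - y) * chr (-n) z :=
      HasCompactSupport.mul_right (hφc.comp_homeomorph (Homeomorph.subRight y))
    have := H (fun z => φ (z - y) * chr (-n) z)
      ((hφ.comp (contDiff_id.sub contDiff_const)).mul (contDiff_chr _)) hc
    rw [iterate_adjDbar_translate_mul_chr hφ] at this
    convert this using 2
    · ext z; ring
    · ext z; ring
  have e2 := integral_congr_ae (μ := volume.restrict cell) (Filter.Eventually.of_forall e)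
  have hc := (continuous_chr (-n)).aestronglyMeasurable (μ := volume)
  rw [integral_cell_integral_translate (hh.mul (isLatticePeriodic_chr _)) (hhm.mul hc)
      (integrableOn_mul_chr hhi _) hφ.continuous hφc,
    integral_cell_integral_translate (hu.mul (isLatticePeriodic_chr _)) (hum.mul hc)
      (integrableOn_mul_chr hui _) h1.continuous h2, h3] at e2
  have e3 : ∫ z in cell, h z * chr (-n) z =
      (dualPt n + k) ^ j * ∫ z in cell, u z * chr (-n) z := by
    apply mul_left_cancel₀ hφ0
    rw [e2]
    ring
  rw [coeff, coeff, e3]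
  ring

lemma IsWeakTwoDbarAdd.integral_mul {k : ℂ} {f g : ℂ → ℂ} (h : IsWeakTwoDbarAdd k f g)
    {φ : ℂ → ℂ} (hφ : ContDiff ℝ (⊤ : ℕ∞) φ) (hφc : HasCompactSupport φ) :
    ∫ z, g z * φ z = ∫ z, f z * adjDbar k φ z := by
  obtain ⟨g₁, g₂, ⟨hf, hg₁, h₁⟩, ⟨-, hg₂, h₂⟩, hg⟩ := h
  have key : ∀ {f φ : ℂ → ℂ}, LocallyIntegrable f → Continuous φ → HasCompactSupport φ →
      Integrable fun z => f z * φ z := fun hf hφ hφc => by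
    simpa only [smul_eq_mul] using hf.integrable_smul_right_of_hasCompactSupport hφ hφc
  have hd := fun e => key hf (contDiff_fderiv_apply hφ e).continuous (hφc.fderiv_apply ℝ e)
  have e1 := key hg₁ hφ.continuous hφc
  have e2 := key hg₂ hφ.continuous hφc
  have e3 := key hf hφ.continuous hφc
  have lhs : ∫ z, g z * φ z = ∫ z, ((1 / I) * (g₁ z * φ z) + (1 / I * I) * (g₂ z * φ z)) +
      k * (f z * φ z) := by
    refine integral_congr_ae ?_
    filter_upwards [hg] with z hz
    rw [hz]
    ring
  have rhs : ∫ z, f z * adjDbar k φ z = ∫ z, k * (f z * φ z) -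
      ((1 / I) * (f z * fderiv ℝ φ z 1) + (1 / I * I) * (f z * fderiv ℝ φ z I)) := by
    congr 1
    ext z
    rw [adjDbar, twoDbar]
    ring
  have i1 : Integrable fun z => (1 / I) * (g₁ z * φ z) + (1 / I * I) * (g₂ z * φ z) :=
    (e1.const_mul _).add (e2.const_mul _)
  have i2 : Integrable fun z =>
      (1 / I) * (f z * fderiv ℝ φ z 1) + (1 / I * I) * (f z * fderiv ℝ φ z I) :=
    ((hd 1).const_mul _).add ((hd I).const_mul _)
  rw [lhs, rhs, integral_add i1 (e3.const_mul _),
    integral_add (e1.const_mul _) (e2.const_mul _), integral_sub (e3.const_mul _) i2,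
    integral_add ((hd 1).const_mul _) ((hd I).const_mul _)]
  simp only [integral_const_mul]
  rw [h₁ φ hφ hφc, h₂ φ hφ hφc]
  ring

lemma hasWeakPartial_fderiv {f : ℂ → ℂ} (hf : ContDiff ℝ 1 f) (e : ℂ) :
    HasWeakPartial e f fun z => fderiv ℝ f z e := by
  have hc : Continuous fun z => fderiv ℝ f z e :=
    (hf.continuous_fderiv one_ne_zero).clm_apply continuous_const
  refine ⟨hf.continuous.locallyIntegrable, hc.locallyIntegrable, fun φ hφ hφc => ?_⟩
  refine integral_mul_fderiv_eq_neg_fderiv_mul_of_integrable ?_ ?_ ?_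
    (fun z _ => hf.differentiable one_ne_zero z) (fun z _ => differentiable_of_contDiff hφ z)
  · exact (hc.mul hφ.continuous).integrable_of_hasCompactSupport hφc.mul_left
  · exact (hf.continuous.mul
      (contDiff_fderiv_apply hφ e).continuous).integrable_of_hasCompactSupport (hφc.fderiv_apply ℝ e).mul_left
  · exact (hf.continuous.mul hφ.continuous).integrable_of_hasCompactSupport hφc.mul_left

lemma isWeakTwoDbarAdd_twoDbar {f : ℂ → ℂ} (hf : ContDiff ℝ 1 f) (k : ℂ) :
    IsWeakTwoDbarAdd k f fun z => twoDbar f z + k * f z :=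
  ⟨_, _, hasWeakPartial_fderiv hf 1, hasWeakPartial_fderiv hf I,
    Filter.Eventually.of_forall fun _ => rfl⟩

lemma IsLatticePeriodic.fderiv {f : ℂ → ℂ} (hf : IsLatticePeriodic f) (e : ℂ) :
    IsLatticePeriodic fun z => fderiv ℝ f z e := fun γ hγ z => by
  have h : (fun z => f (z + γ)) = f := funext (hf γ hγ)
  change _root_.fderiv ℝ f (z + γ) e = _root_.fderiv ℝ f z e
  conv_rhs => rw [← h]
  rw [fderiv_comp_add_right]

lemma IsLatticePeriodic.twoDbar {f : ℂ → ℂ} (hf : IsLatticePeriodic f) :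
    IsLatticePeriodic (twoDbar f) := fun γ hγ z => by
  have h1 := hf.fderiv 1 γ hγ z
  have h2 := hf.fderiv I γ hγ z
  simp only at h1 h2
  rw [ScalarModel.twoDbar, ScalarModel.twoDbar, h1, h2]

lemma memSobolev_of_contDiff (m : ℕ) {f : ℂ → ℂ} (hf : ContDiff ℝ (⊤ : ℕ∞) f)
    (hp : IsLatticePeriodic f) : MemSobolev m f := by
  induction m generalizing f with
  | zero => exact hp.memL2 hf.continuous
  | succ m ih =>
    exact ⟨hp.memL2 hf.continuous, _, _, hasWeakPartial_fderiv (hf.of_le (by simp)) 1,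
      hasWeakPartial_fderiv (hf.of_le (by simp)) I,
      ih (contDiff_fderiv_apply hf 1) (hp.fderiv 1),
      ih (contDiff_fderiv_apply hf I) (hp.fderiv I)⟩

/-! ### Fourier series of smooth functions -/

lemma IsLatticePeriodic.integrableOn {f : ℂ → ℂ} (hp : IsLatticePeriodic f) (hf : Continuous f) :
    IntegrableOn f cell := (hp.memL2 hf).integrableOn

lemma coeff_twoDbar {f : ℂ → ℂ} (hf : ContDiff ℝ (⊤ : ℕ∞) f) (hp : IsLatticePeriodic f)
    (n : Fin 2 → ℤ) : coeff (twoDbar f) n = dualPt n * coeff f n := by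
  have h := isWeakTwoDbarAdd_twoDbar (hf.of_le (by simp)) 0
  simp only [zero_mul, add_zero] at h
  have hc := (contDiff_twoDbar hf).continuous
  have := coeff_of_weak (k := 0) 1 hp hf.continuous.aestronglyMeasurable
    (hp.integrableOn hf.continuous) hp.twoDbar hc.aestronglyMeasurable (hp.twoDbar.integrableOn hc)
    (fun φ hφ hφc => h.integral_mul hφ hφc) n
  rw [← this]
  simp

/-- The class of smooth periodic functions is stable under `2D_{z̄}`, so the elliptic gain can be
iterated from the trivial bound on the coefficients. -/
lemma rapid_coeff {f : ℂ → ℂ} (hf : ContDiff ℝ (⊤ : ℕ∞) f) (hp : IsLatticePeriodic f) :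
    Rapid (coeff f) := by
  intro m
  induction m generalizing f with
  | zero => exact decay_coeff f
  | succ m ih =>
    refine (ih hf hp).succ_of_mul_add (k := 0) ?_
    have h := ih (contDiff_twoDbar hf) hp.twoDbar
    rw [show coeff (twoDbar f) = _ from funext (coeff_twoDbar hf hp)] at h
    simpa only [add_zero] using h

lemma series_coeff {f : ℂ → ℂ} (hf : ContDiff ℝ (⊤ : ℕ∞) f) (hp : IsLatticePeriodic f) :
    series (coeff f) = f := by
  have hs := (rapid_coeff hf hp).summable
  exact eq_of_coeff_eq isLatticePeriodic_series (continuous_series hs) hp hf.continuous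
    (coeff_series hs)

lemma twoDbar_series_add {a : (Fin 2 → ℤ) → ℂ} (ha : Summable fun n => weight n * ‖a n‖)
    (k z : ℂ) :
    twoDbar (series a) z + k * series a z = series (fun n => (dualPt n + k) * a n) z := by
  have h1 : Summable fun n => ‖a n‖ := ha.of_nonneg_of_le (fun _ => norm_nonneg _)
    fun n => by nlinarith [norm_nonneg (a n), one_le_weight n]
  have h2 : Summable fun n => ‖dualPt n * a n‖ := ha.of_nonneg_of_le (fun _ => norm_nonneg _)
    fun n => by
      rw [norm_mul]
      exact mul_le_mul_of_nonneg_right (norm_dualPt_le_weight n) (norm_nonneg _)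
  rw [twoDbar_series ha, series, series, series, ← tsum_mul_left,
    ← (summable_series h2 z).tsum_add ((summable_series h1 z).mul_left k)]
  exact tsum_congr fun n => by ring

/-! ### Regularity -/

lemma MemKerP.coeff_eq {V : ℂ → ℂ} (hV : ContDiff ℝ (⊤ : ℕ∞) V) (hVp : IsLatticePeriodic V)
    {α k : ℂ} {u : ℂ → ℂ} (hu : MemKerP V α k u) (n : Fin 2 → ℤ) :
    (dualPt n + k) ^ 2 * coeff u n = α ^ 2 * conv (coeff u) (coeff V) n := by
  obtain ⟨⟨hL2, g₁, g₂, ⟨hul, -⟩, -⟩, v, w, huv, hvw, hw⟩ := hu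
  obtain ⟨C, hC⟩ := hVp.bounded hV.continuous
  have hp : IsLatticePeriodic fun z => α ^ 2 * (u z * V z) := fun γ hγ z => by
    simp only [hL2.1 γ hγ, hVp γ hγ]
  have hVu : IntegrableOn (fun z => u z * V z) cell :=
    Integrable.mul_bdd (c := C) hL2.integrableOn hV.continuous.aestronglyMeasurable
      (Filter.Eventually.of_forall hC)
  have h := coeff_of_weak (k := k) 2 hL2.1 hul.aestronglyMeasurable hL2.integrableOn hp
    (aestronglyMeasurable_const.mul
      (hul.aestronglyMeasurable.mul hV.continuous.aestronglyMeasurable))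
    (hVu.const_mul (α ^ 2)) (fun φ hφ hφc => by
      rw [Function.iterate_succ_apply, Function.iterate_one,
        ← huv.integral_mul (contDiff_adjDbar k hφ) (hasCompactSupport_adjDbar k hφc),
        ← hvw.integral_mul hφ hφc]
      refine integral_congr_ae ?_
      filter_upwards [hw] with z hz
      rw [sub_eq_zero.1 hz]
      ring) n
  rw [h]
  have e := coeff_mul_series hL2.integrableOn (rapid_coeff hV hVp).summable n
  rw [series_coeff hV hVp] at e
  rw [← e, coeff, coeff]
  simp only [mul_assoc]
  rw [integral_const_mul]
  ring

/-- Solutions of the equation in Fourier space decay rapidly. -/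
lemma rapid_of_sq_mul_eq {a b : (Fin 2 → ℤ) → ℂ} {α k : ℂ} (ha : Decay 0 a) (hb : Rapid b)
    (h : ∀ n, (dualPt n + k) ^ 2 * a n = α ^ 2 * conv a b n) : Rapid a := by
  intro m
  induction m with
  | zero => exact ha
  | succ m ih =>
    refine ih.succ_of_sq_mul (k := k) ?_
    simp only [h]
    exact (ih.conv hb).const_mul _

lemma MemKerP.rapid {V : ℂ → ℂ} (hV : ContDiff ℝ (⊤ : ℕ∞) V) (hVp : IsLatticePeriodic V)
    {α k : ℂ} {u : ℂ → ℂ} (hu : MemKerP V α k u) : Rapid (coeff u) :=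
  rapid_of_sq_mul_eq (decay_coeff u) (rapid_coeff hV hVp) (hu.coeff_eq hV hVp)

lemma MemKerP.ae_eq_series {V : ℂ → ℂ} (hV : ContDiff ℝ (⊤ : ℕ∞) V)
    (hVp : IsLatticePeriodic V) {α k : ℂ} {u : ℂ → ℂ} (hu : MemKerP V α k u) :
    ∀ᵐ z, series (coeff u) z = u z := by
  have hs := (hu.rapid hV hVp).summable
  exact ae_eq_of_coeff_eq (isLatticePeriodic_series.memL2 (continuous_series hs)) hu.1.1
    (coeff_series hs)

lemma memKerP_series {V : ℂ → ℂ} (hV : ContDiff ℝ (⊤ : ℕ∞) V) (hVp : IsLatticePeriodic V)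
    {α k : ℂ} {a : (Fin 2 → ℤ) → ℂ} (ha : Rapid a)
    (h : ∀ n, (dualPt n + k) ^ 2 * a n = α ^ 2 * conv a (coeff V) n) :
    MemKerP V α k (series a) := by
  have ha' : Rapid fun n => (dualPt n + k) * a n := by
    simpa only [add_mul] using ha.dualPt_mul.add (ha.const_mul k)
  refine ⟨memSobolev_of_contDiff 2 (contDiff_series ha) isLatticePeriodic_series,
    series fun n => (dualPt n + k) * a n, series fun n => (dualPt n + k) * ((dualPt n + k) * a n),
    ?_, ?_, Filter.Eventually.of_forall fun z => ?_⟩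
  · have := isWeakTwoDbarAdd_twoDbar ((contDiff_series ha).of_le (by simp)) k
    simpa only [twoDbar_series_add ha.summable_weight] using this
  · have := isWeakTwoDbarAdd_twoDbar ((contDiff_series ha').of_le (by simp)) k
    simpa only [twoDbar_series_add ha'.summable_weight] using this
  · have e : (fun n => (dualPt n + k) * ((dualPt n + k) * a n)) =
        fun n => α ^ 2 * conv a (coeff V) n := funext fun n => by rw [← h]; ring
    have e2 := series_conv ha.summable (rapid_coeff hV hVp).summable z
    rw [series_coeff hV hVp] at e2
    rw [e, mul_assoc, mul_comm (V z), ← e2, series, series, ← tsum_mul_left, sub_eq_zero]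
    exact tsum_congr fun n => by ring

lemma IsScalarPotential.contDiff {V : ℂ → ℂ} (hV : IsScalarPotential V) :
    ContDiff ℝ (⊤ : ℕ∞) V :=
  contDiffOn_univ.1 (hV.analytic.contDiffOn uniqueDiffOn_univ)

/-! ### A flat band forces a zero -/

/-- For `k` outside the dual lattice, `2D_{z̄} + k` is injective on smooth periodic functions. -/
lemma eq_zero_of_twoDbar_add_eq_zero {q : ℂ → ℂ} {k : ℂ} (hk : ∀ n, dualPt n + k ≠ 0)
    (hq : ContDiff ℝ (⊤ : ℕ∞) q) (hp : IsLatticePeriodic q)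
    (h : ∀ z, twoDbar q z + k * q z = 0) : q = 0 := by
  have hr := rapid_coeff hq hp
  have h2 : (fun n => (dualPt n + k) * coeff q n) = 0 := by
    refine series_injective ?_ fun z => ?_
    · have : Rapid fun n => (dualPt n + k) * coeff q n := by
        simpa only [add_mul] using hr.dualPt_mul.add (hr.const_mul k)
      exact this.summable
    · rw [← twoDbar_series_add hr.summable_weight, series_coeff hq hp, h]
  rw [← series_coeff hq hp]
  ext z
  rw [series, Pi.zero_apply]
  refine (tsum_congr fun n => ?_).trans tsum_zero
  rw [(mul_eq_zero.1 (congrFun h2 n)).resolve_left (hk n), zero_mul]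

/-- Elements of the kernel as smooth solutions of a first order system. -/
lemma MemKerP.exists_system {V : ℂ → ℂ} (hV : ContDiff ℝ (⊤ : ℕ∞) V)
    (hVp : IsLatticePeriodic V) {α k : ℂ} {u : ℂ → ℂ} (hu : MemKerP V α k u) (z : ℂ) :
    let A := series (coeff u)
    let B := series fun n => (dualPt n + k) * coeff u n
    twoDbar A z + k * A z = B z ∧ twoDbar B z + k * B z = α ^ 2 * V z * A z := by
  have ha := hu.rapid hV hVp
  have ha' : Rapid fun n => (dualPt n + k) * coeff u n := by
    simpa only [add_mul] using ha.dualPt_mul.add (ha.const_mul k)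
  refine ⟨twoDbar_series_add ha.summable_weight k z, ?_⟩
  rw [twoDbar_series_add ha'.summable_weight]
  have e : (fun n => (dualPt n + k) * ((dualPt n + k) * coeff u n)) =
      fun n => α ^ 2 * conv (coeff u) (coeff V) n :=
    funext fun n => by rw [← hu.coeff_eq hV hVp]; ring
  have e2 := series_conv ha.summable (rapid_coeff hV hVp).summable z
  rw [series_coeff hV hVp] at e2
  rw [e, mul_assoc, mul_comm (V z), ← e2, series, series, ← tsum_mul_left]
  exact tsum_congr fun n => by ring

/-- Two solutions of the first order system, for `0` and for `k` outside the dual lattice: if the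
first one has no zero, the second one vanishes. -/
lemma eq_zero_of_system {V U U' A A' : ℂ → ℂ} {c k : ℂ} (hk : ∀ n, dualPt n + k ≠ 0)
    (hU : ContDiff ℝ (⊤ : ℕ∞) U) (hU' : ContDiff ℝ (⊤ : ℕ∞) U')
    (hA : ContDiff ℝ (⊤ : ℕ∞) A) (hA' : ContDiff ℝ (⊤ : ℕ∞) A')
    (pU : IsLatticePeriodic U) (pU' : IsLatticePeriodic U')
    (pA : IsLatticePeriodic A) (pA' : IsLatticePeriodic A')
    (e1 : ∀ z, twoDbar U z = U' z) (e2 : ∀ z, twoDbar U' z = c * V z * U z)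
    (e3 : ∀ z, twoDbar A z + k * A z = A' z)
    (e4 : ∀ z, twoDbar A' z + k * A' z = c * V z * A z)
    (hne : ∀ z, ¬ (U z = 0 ∧ U' z = 0)) : A = 0 := by
  have dU := differentiable_of_contDiff hU
  have dU' := differentiable_of_contDiff hU'
  have dA := differentiable_of_contDiff hA
  have dA' := differentiable_of_contDiff hA'
  -- The Wronskian of the two solutions: the potential terms cancel and `2D_{z̄} + k` annihilates
  -- it.
  have hW : (fun z => U z * A' z + (-1) * (A z * U' z)) = 0 := by
    refine eq_zero_of_twoDbar_add_eq_zero hk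
      ((hU.mul hA').add (contDiff_const.mul (hA.mul hU'))) (fun γ hγ z => ?_) fun z => ?_
    · simp only [pU γ hγ, pU' γ hγ, pA γ hγ, pA' γ hγ]
    · rw [twoDbar_add ((dU z).fun_mul (dA' z)) (((dA z).fun_mul (dU' z)).const_mul _),
        twoDbar_const_mul _ ((dA z).fun_mul (dU' z)), twoDbar_mul (dU z) (dA' z),
        twoDbar_mul (dA z) (dU' z)]
      linear_combination U z * e4 z + A' z * e1 z - A z * e2 z - U' z * e3 z
  have hW' : ∀ z, U z * A' z = A z * U' z := fun z => by
    have := congrFun hW z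
    simp only [Pi.zero_apply] at this
    linear_combination this
  have hden : ∀ z, starRingEnd ℂ (U z) * U z + starRingEnd ℂ (U' z) * U' z ≠ 0 := by
    intro z h
    rw [← normSq_eq_conj_mul_self, ← normSq_eq_conj_mul_self, ← ofReal_add, ofReal_eq_zero] at h
    have h1 := normSq_nonneg (U z)
    have h2 := normSq_nonneg (U' z)
    exact hne z ⟨normSq_eq_zero.1 (by linarith), normSq_eq_zero.1 (by linarith)⟩
  -- The Hermitian projection of `(A, A')` onto `(U, U')`: a globally smooth formula for the ratio,
  -- valid even where one of `U`, `U'` vanishes.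
  set f : ℂ → ℂ := fun z => (starRingEnd ℂ (U z) * A z + starRingEnd ℂ (U' z) * A' z) *
    (starRingEnd ℂ (U z) * U z + starRingEnd ℂ (U' z) * U' z)⁻¹ with hf
  have hcU : ContDiff ℝ (⊤ : ℕ∞) fun z => starRingEnd ℂ (U z) := conjCLE.contDiff.comp hU
  have hcU' : ContDiff ℝ (⊤ : ℕ∞) fun z => starRingEnd ℂ (U' z) := conjCLE.contDiff.comp hU'
  have hfs : ContDiff ℝ (⊤ : ℕ∞) f :=
    ((hcU.mul hA).add (hcU'.mul hA')).mul (((hcU.mul hU).add (hcU'.mul hU')).inv hden)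
  have df := differentiable_of_contDiff hfs
  have hfA : A = fun z => f z * U z := by
    ext z
    have := hden z
    simp only [hf]
    field_simp
    linear_combination (-starRingEnd ℂ (U' z)) * hW' z
  have hfA' : A' = fun z => f z * U' z := by
    ext z
    have := hden z
    simp only [hf]
    field_simp
    linear_combination (starRingEnd ℂ (U z)) * hW' z
  have hf0 : f = 0 := by
    refine eq_zero_of_twoDbar_add_eq_zero hk hfs (fun γ hγ z => ?_) fun z => ?_
    · simp only [hf, pU γ hγ, pU' γ hγ, pA γ hγ, pA' γ hγ]
    · have h3 := e3 z
      have h4 := e4 z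
      rw [hfA, hfA', twoDbar_mul (df z) (dU z)] at h3
      rw [hfA, hfA', twoDbar_mul (df z) (dU' z)] at h4
      have h5 : (twoDbar f z + k * f z) * U z = 0 := by
        linear_combination h3 - f z * e1 z
      have h6 : (twoDbar f z + k * f z) * U' z = 0 := by
        linear_combination h4 - f z * e2 z
      by_contra h7
      exact hne z ⟨(mul_eq_zero.1 h5).resolve_left h7, (mul_eq_zero.1 h6).resolve_left h7⟩
  rw [hfA, hf0]
  ext z
  simp

/-- Real parts of dual lattice points are multiples of `2π`. This makes `k = 1` an admissible
parameter, and one such `k` suffices for the forward implication. -/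
lemma dualPt_add_one_ne_zero (n : Fin 2 → ℤ) : dualPt n + 1 ≠ 0 := by
  intro h
  have h0 := congrArg re h
  simp only [dualPt, add_re, one_re, zero_re] at h0
  have hpi := Real.pi_gt_three
  rcases lt_trichotomy (n 0) 0 with h1 | h1 | h1
  · have : (n 0 : ℝ) ≤ -1 := by exact_mod_cast Int.le_sub_one_of_lt h1
    nlinarith
  · rw [h1] at h0
    norm_num at h0
  · have : (1 : ℝ) ≤ n 0 := by exact_mod_cast h1
    nlinarith

lemma exists_zero_of_mem_magicSet {V : ℂ → ℂ} (hV : ContDiff ℝ (⊤ : ℕ∞) V)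
    (hVp : IsLatticePeriodic V) {α : ℂ} {u : ℂ → ℂ} (hu : MemKerP V α 0 u)
    (hα : α ∈ magicSet V) :
    ∃ z₀, series (coeff u) z₀ = 0 ∧ twoDbar (series (coeff u)) z₀ = 0 := by
  obtain ⟨v, hv, hv0⟩ := hα 1
  by_contra! hne
  refine hv0 ?_
  have hsys := hu.exists_system hV hVp
  have hsys' := hv.exists_system hV hVp
  simp only [zero_mul, add_zero] at hsys
  have ru := hu.rapid hV hVp
  have rv := hv.rapid hV hVp
  have rv' : Rapid fun n => (dualPt n + 1) * coeff v n := by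
    simpa only [add_mul] using rv.dualPt_mul.add (rv.const_mul 1)
  have h0 := eq_zero_of_system dualPt_add_one_ne_zero (contDiff_series ru)
    (contDiff_series ru.dualPt_mul) (contDiff_series rv) (contDiff_series rv')
    isLatticePeriodic_series isLatticePeriodic_series isLatticePeriodic_series
    isLatticePeriodic_series (fun z => (hsys z).1) (fun z => (hsys z).2)
    (fun z => (hsys' z).1) (fun z => (hsys' z).2)
    (fun z h => hne z h.1 ((hsys z).1.trans h.2))
  filter_upwards [hv.ae_eq_series hV hVp] with z hz
  rw [← hz, h0, Pi.zero_apply]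

/-! ### A zero produces a flat band -/

lemma isNonzero_series {a : (Fin 2 → ℤ) → ℂ} (ha : Rapid a) (h : a ≠ 0) : IsNonzero (series a) := by
  intro h0
  refine h (series_injective ha.summable fun z => ?_)
  exact congrFun (Measure.eq_of_ae_eq (g := fun _ => (0 : ℂ)) h0
    (continuous_series ha.summable) continuous_const) z

lemma exists_weight_gt (C : ℝ) : ∃ n, C < weight n := by
  by_contra! h
  have hC : 0 < C := (weight_pos 0).trans_le (h 0)
  have h1 : Summable fun _ : Fin 2 → ℤ => (C ^ 3)⁻¹ :=
    summable_inv_weight.of_nonneg_of_le (fun _ => by positivity) fun n => by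
      have := weight_pos n
      have := h n
      gcongr
  rw [summable_const_iff] at h1
  exact (by positivity : (C ^ 3)⁻¹ ≠ 0) h1

lemma finite_weight_le (C : ℝ) : {n | weight n ≤ C}.Finite := by
  have h := summable_inv_weight.tendsto_cofinite_zero
  have hC : 0 < (max C 1 ^ 3)⁻¹ := by positivity
  have h2 := h.eventually (gt_mem_nhds hC)
  rw [Filter.eventually_cofinite] at h2
  refine h2.subset fun n hn => ?_
  have := weight_pos n
  have h3 : weight n ≤ max C 1 := le_max_of_le_left hn
  simp only [Set.mem_ofPred_eq, not_lt]
  gcongr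

/-- The Fourier coefficients, up to a factor, of the fundamental solution of `2D_{z̄} + k` with
pole at `z₀`. -/
def greenCoeff (k z₀ : ℂ) (n : Fin 2 → ℤ) : ℂ := chr (-n) z₀ / (dualPt n + k)

section Green

variable {k z₀ : ℂ} (hk : ∀ n, dualPt n + k ≠ 0)

include hk

lemma mul_greenCoeff (n : Fin 2 → ℤ) : (dualPt n + k) * greenCoeff k z₀ n = chr (-n) z₀ := by
  rw [greenCoeff, mul_div_cancel₀ _ (hk n)]

lemma decay_one_greenCoeff : Decay 1 (greenCoeff k z₀) := by
  have h1 : Decay 0 fun n => (dualPt n + k) * greenCoeff k z₀ n := by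
    simpa only [mul_greenCoeff hk] using decay_chr_neg z₀
  refine Decay.succ_of_mul_add (k := k) ?_ h1
  -- Beyond the threshold `2 + ‖k‖` on the weight, `|κₙ + k| > 1`; only finitely many coefficients
  -- remain.
  obtain ⟨C, hC⟩ := ((finite_weight_le (2 + ‖k‖)).image
    (fun n => ‖greenCoeff k z₀ n‖)).bddAbove
  refine decay_zero_iff.2 ⟨max C 1, fun n => ?_⟩
  by_cases hn : weight n ≤ 2 + ‖k‖
  · exact (hC (Set.mem_image_of_mem _ hn)).trans (le_max_left _ _)
  · refine le_trans ?_ (le_max_right _ _)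
    have h2 := weight_le_add n k
    rw [greenCoeff, norm_div, norm_chr]
    refine div_le_one_of_le₀ ?_ (norm_nonneg _)
    push Not at hn
    linarith

/-- The Leibniz rule for the fundamental solution: the derivative falling on it gives a Dirac mass
at `z₀`, weighted by the value of the other factor there. -/
lemma mul_conv_greenCoeff {b : (Fin 2 → ℤ) → ℂ} (hb : Rapid b) (n : Fin 2 → ℤ) :
    (dualPt n + k) * conv (greenCoeff k z₀) b n =
      chr (-n) z₀ * series b z₀ + conv (greenCoeff k z₀) (fun n => dualPt n * b n) n := by
  have h1 : Decay 0 fun n => (dualPt n + k) * greenCoeff k z₀ n := by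
    simpa only [mul_greenCoeff hk] using decay_chr_neg z₀
  rw [dualPt_mul_conv ((decay_one_greenCoeff hk).mono zero_le_one) h1 hb.summable
    hb.dualPt_mul.summable]
  simp only [mul_greenCoeff hk]
  rw [conv_chr_neg]

lemma mul_conv_greenCoeff_coeff {g : ℂ → ℂ} (hg : ContDiff ℝ (⊤ : ℕ∞) g)
    (hp : IsLatticePeriodic g) (n : Fin 2 → ℤ) :
    (dualPt n + k) * conv (greenCoeff k z₀) (coeff g) n =
      chr (-n) z₀ * g z₀ + conv (greenCoeff k z₀) (coeff (twoDbar g)) n := by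
  rw [mul_conv_greenCoeff hk (rapid_coeff hg hp), series_coeff hg hp,
    show coeff (twoDbar g) = _ from funext (coeff_twoDbar hg hp)]

/-- The product of the fundamental solution with a function vanishing to order `m` at the pole. -/
lemma decay_conv_greenCoeff (m : ℕ) {g : ℂ → ℂ} (hg : ContDiff ℝ (⊤ : ℕ∞) g)
    (hp : IsLatticePeriodic g) (h0 : ∀ j < m, (twoDbar^[j] g) z₀ = 0) :
    Decay m (conv (greenCoeff k z₀) (coeff g)) := by
  induction m generalizing g with
  | zero => exact ((decay_one_greenCoeff hk).mono zero_le_one).conv (rapid_coeff hg hp)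
  | succ m ih =>
    refine (ih hg hp fun j hj => h0 j (hj.trans (Nat.lt_succ_self m))).succ_of_mul_add (k := k) ?_
    have h1 := h0 0 (Nat.succ_pos m)
    rw [Function.iterate_zero_apply] at h1
    simp only [mul_conv_greenCoeff_coeff hk hg hp, h1, mul_zero, zero_add]
    exact ih (contDiff_twoDbar hg) hp.twoDbar fun j hj => h0 (j + 1) (Nat.succ_lt_succ hj)

/-- If the fundamental solution annihilates `g`, then `g` vanishes at the pole and the fundamental
solution annihilates `2D_{z̄} g`. -/
lemma eq_zero_of_conv_greenCoeff_eq_zero {g : ℂ → ℂ} (hg : ContDiff ℝ (⊤ : ℕ∞) g)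
    (hp : IsLatticePeriodic g) (h : conv (greenCoeff k z₀) (coeff g) = 0) :
    g z₀ = 0 ∧ conv (greenCoeff k z₀) (coeff (twoDbar g)) = 0 := by
  have h1 := mul_conv_greenCoeff_coeff (z₀ := z₀) hk hg hp
  simp only [h, Pi.zero_apply, mul_zero] at h1
  have h0 : g z₀ = 0 := by
    -- The Dirac term has coefficients of constant modulus `‖g z₀‖`, yet it must cancel a sequence
    -- that tends to zero.
    obtain ⟨C, hC⟩ := (decay_one_greenCoeff (z₀ := z₀) hk).conv
      (rapid_coeff (contDiff_twoDbar hg) hp.twoDbar)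
    by_contra hne
    have hpos : 0 < ‖g z₀‖ := norm_pos_iff.2 hne
    obtain ⟨n, hn⟩ := exists_weight_gt (C / ‖g z₀‖)
    have h2 := hC n
    rw [← neg_eq_of_add_eq_zero_right (h1 n).symm, norm_neg, norm_mul, norm_chr, one_mul, pow_one]
      at h2
    rw [div_lt_iff₀ hpos] at hn
    linarith
  refine ⟨h0, ?_⟩
  ext n
  have := h1 n
  rw [h0, mul_zero, zero_add] at this
  exact this.symm

lemma iterate_twoDbar_eq_zero_of_conv_eq_zero (j : ℕ) {g : ℂ → ℂ}
    (hg : ContDiff ℝ (⊤ : ℕ∞) g) (hp : IsLatticePeriodic g)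
    (h : conv (greenCoeff k z₀) (coeff g) = 0) : (twoDbar^[j] g) z₀ = 0 := by
  obtain ⟨h1, h2⟩ := eq_zero_of_conv_greenCoeff_eq_zero hk hg hp h
  induction j generalizing g with
  | zero => exact h1
  | succ j ih =>
    obtain ⟨h3, h4⟩ := eq_zero_of_conv_greenCoeff_eq_zero hk (contDiff_twoDbar hg) hp.twoDbar h2
    exact ih (contDiff_twoDbar hg) hp.twoDbar h2 h3 h4

end Green

/-! ### A function vanishing to fourth order exactly on a translate of the lattice -/

lemma twoDbar_sum_planeWave {ι : Type*} (s : Finset ι) (c μ : ι → ℂ) (z₀ z : ℂ) :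
    twoDbar (fun z => ∑ i ∈ s, c i * planeWave (μ i) (z - z₀)) z =
      ∑ i ∈ s, c i * μ i * planeWave (μ i) (z - z₀) := by
  classical
  have hd : ∀ i, DifferentiableAt ℝ (fun z => planeWave (μ i) (z - z₀)) z := fun i =>
    ((contDiff_planeWave (μ i) (n := 1)).differentiable (by simp) _).comp z
      (differentiableAt_id.sub_const z₀)
  induction s using Finset.induction_on with
  | empty => simp [twoDbar]
  | insert i s hi ih =>
    simp only [Finset.sum_insert hi]
    rw [twoDbar_add ((hd i).const_mul _) (DifferentiableAt.fun_sum fun j _ => (hd j).const_mul _),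
      ih, twoDbar_const_mul _ (hd i), twoDbar_comp_sub, twoDbar_planeWave]
    ring

lemma iterate_twoDbar_sum_planeWave {ι : Type*} (s : Finset ι) (c μ : ι → ℂ) (z₀ : ℂ) (j : ℕ) :
    twoDbar^[j] (fun z => ∑ i ∈ s, c i * planeWave (μ i) (z - z₀)) =
      fun z => ∑ i ∈ s, c i * μ i ^ j * planeWave (μ i) (z - z₀) := by
  induction j generalizing c with
  | zero => simp
  | succ j ih =>
    rw [Function.iterate_succ_apply]
    have : twoDbar (fun z => ∑ i ∈ s, c i * planeWave (μ i) (z - z₀)) =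
        fun z => ∑ i ∈ s, (c i * μ i) * planeWave (μ i) (z - z₀) :=
      funext fun z => twoDbar_sum_planeWave s c μ z₀ z
    rw [this, ih]
    ext z
    exact Finset.sum_congr rfl fun i _ => by ring

/-- The trigonometric polynomial `(2 - 2 cos θ₀)² + (2 - 2 cos θ₁)²`, where `θ₀` and `θ₁` are the
angular coordinates centred at `z₀`. -/
def cutoff (z₀ z : ℂ) : ℂ := ∑ i : Fin 2 × Fin 5, (![1, -4, 6, -4, 1] i.2 : ℂ) *
  planeWave (dualPt (((i.2 : ℕ) - 2 : ℤ) • Pi.single i.1 1)) (z - z₀)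

lemma dualPt_zsmul (m : ℤ) (n : Fin 2 → ℤ) : dualPt (m • n) = m * dualPt n := by
  apply Complex.ext <;> simp [dualPt] <;> ring

lemma contDiff_cutoff (z₀ : ℂ) : ContDiff ℝ (⊤ : ℕ∞) (cutoff z₀) :=
  ContDiff.sum fun _ _ => contDiff_const.mul
    ((contDiff_planeWave _).comp (contDiff_id.sub contDiff_const))

lemma isLatticePeriodic_cutoff (z₀ : ℂ) : IsLatticePeriodic (cutoff z₀) := fun γ hγ z => by
  refine Finset.sum_congr rfl fun i _ => ?_
  have := isLatticePeriodic_chr (((i.2 : ℕ) - 2 : ℤ) • Pi.single i.1 1) γ hγ (z - z₀)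
  rw [chr, chr] at this
  rw [← this, sub_add_eq_add_sub]

/-- The bracket is the fourth central difference of `xʲ` at `0`: it vanishes for `j < 4` and equals
`4! = 24` for `j = 4`. -/
lemma iterate_twoDbar_cutoff (z₀ : ℂ) (j : ℕ) : (twoDbar^[j] (cutoff z₀)) z₀ =
    ∑ i : Fin 2, dualPt (Pi.single i 1) ^ j * ((-2) ^ j - 4 * (-1) ^ j + 6 * 0 ^ j - 4 + 2 ^ j) := by
  have h : cutoff z₀ = fun z => ∑ i ∈ (Finset.univ : Finset (Fin 2 × Fin 5)),
      (![1, -4, 6, -4, 1] i.2 : ℂ) *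
        planeWave (dualPt (((i.2 : ℕ) - 2 : ℤ) • Pi.single i.1 1)) (z - z₀) := rfl
  rw [h, iterate_twoDbar_sum_planeWave]
  simp only [sub_self, planeWave_zero_right, mul_one, dualPt_zsmul, mul_pow]
  rw [Fintype.sum_prod_type]
  refine Finset.sum_congr rfl fun i _ => ?_
  simp [Fin.sum_univ_five]
  norm_num
  ring

lemma iterate_twoDbar_cutoff_eq_zero (z₀ : ℂ) {j : ℕ} (hj : j < 4) :
    (twoDbar^[j] (cutoff z₀)) z₀ = 0 := by
  rw [iterate_twoDbar_cutoff]
  refine Finset.sum_eq_zero fun i _ => ?_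
  interval_cases j <;> norm_num

lemma iterate_twoDbar_cutoff_ne_zero (z₀ : ℂ) : (twoDbar^[4] (cutoff z₀)) z₀ ≠ 0 := by
  have h3 : √3 ≠ 0 := by positivity
  have hpi := Real.pi_ne_zero
  rw [iterate_twoDbar_cutoff, Fin.sum_univ_two]
  intro h
  have h1 : dualPt (Pi.single 0 1) ^ 4 + dualPt (Pi.single 1 1) ^ 4 = 0 := by
    norm_num at h
    linear_combination h / 24
  have e0 : dualPt (Pi.single 0 1) = ((2 * Real.pi / √3 : ℝ) : ℂ) * (√3 + I) := by
    apply Complex.ext <;> simp [dualPt]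
  have e1 : dualPt (Pi.single 1 1) = ((2 * Real.pi / √3 : ℝ) : ℂ) * (2 * I) := by
    apply Complex.ext <;> simp [dualPt]; field_simp
  have hs : (√3 : ℂ) ^ 2 = 3 := by
    rw [← ofReal_pow, Real.sq_sqrt (by norm_num)]; norm_num
  rw [e0, e1, mul_pow, mul_pow, ← mul_add] at h1
  have hne : ((2 * Real.pi / √3 : ℝ) : ℂ) ^ 4 ≠ 0 := by
    refine pow_ne_zero _ ?_
    rw [ofReal_ne_zero]
    positivity
  have h2 := (mul_eq_zero.1 h1).resolve_left hne
  -- Here `(√3 + i)⁴ = -8 + 8√3 i` and `(2i)⁴ = 16`, so the contributions of the two directions do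
  -- not cancel.
  have h4 : (8 : ℂ) + 8 * √3 * I = 0 := by
    linear_combination h2 - (√3 ^ 2 + 3 + 6 * I ^ 2 + 4 * √3 * I) * hs -
      (4 * √3 * I + 17 * I ^ 2 + 1) * I_sq
  have := congrArg re h4
  simp at this

lemma planeWave_neg_left (κ z : ℂ) : planeWave (-κ) z = starRingEnd ℂ (planeWave κ z) := by
  have h1 := planeWave_neg_left_mul κ z
  have h2 : starRingEnd ℂ (planeWave κ z) * planeWave κ z = 1 := by
    rw [← normSq_eq_conj_mul_self, normSq_eq_norm_sq, norm_planeWave]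
    simp
  exact mul_right_cancel₀ (planeWave_ne_zero κ z) (h1.trans h2.symm)

/-- Each block of five terms is the expansion of `(e - 1)² (ē - 1)²` with `|e| = 1`. Nonnegativity
of both blocks confines the zeros to points where both characters equal `1`. -/
lemma cutoff_eq (z₀ z : ℂ) : cutoff z₀ z =
    ((∑ i : Fin 2, normSq (chr (Pi.single i 1) (z - z₀) - 1) ^ 2 : ℝ) : ℂ) := by
  rw [cutoff, Fintype.sum_prod_type]
  push_cast
  refine Finset.sum_congr rfl fun i _ => ?_
  set κ := dualPt (Pi.single i 1)
  set e := planeWave κ (z - z₀)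
  set e' := planeWave (-κ) (z - z₀)
  have h : e' * e = 1 := planeWave_neg_left_mul _ _
  have h2 : planeWave (2 * κ) (z - z₀) = e * e := by rw [two_mul, planeWave_add_left]
  have h2' : planeWave (-2 * κ) (z - z₀) = e' * e' := by
    rw [neg_mul, two_mul, neg_add, planeWave_add_left]
  have hn : (normSq (chr (Pi.single i 1) (z - z₀) - 1) : ℂ) = (e' - 1) * (e - 1) := by
    rw [normSq_eq_conj_mul_self, map_sub, map_one, chr, ← planeWave_neg_left]
  rw [hn]
  simp only [dualPt_zsmul, Fin.sum_univ_five]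
  simp
  rw [neg_mul] at h2'
  linear_combination h2 + h2' + (2 * (e + e') - e' * e - 5) * h

lemma countable_cutoff_zeros (z₀ : ℂ) : {z | cutoff z₀ z = 0}.Countable := by
  refine (Set.countable_range fun p : ℤ × ℤ => z₀ + (p.1 + p.2 * omega)).mono fun z hz => ?_
  rw [Set.mem_ofPred_eq, cutoff_eq, ofReal_eq_zero,
    Finset.sum_eq_zero_iff_of_nonneg fun _ _ => by positivity] at hz
  obtain ⟨x, hx⟩ := latticeCoord.surjective (z - z₀)
  have key : ∀ i, ∃ m : ℤ, x i = m := by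
    intro i
    have h1 := hz i (Finset.mem_univ i)
    rw [sq_eq_zero_iff, map_eq_zero, sub_eq_zero, ← hx, latticeCoord_apply, chr_apply,
      exp_eq_one_iff] at h1
    obtain ⟨m, hm⟩ := h1
    refine ⟨m, ?_⟩
    have h2 : ((Pi.single i 1 : Fin 2 → ℤ) 0 * x 0 + (Pi.single i 1 : Fin 2 → ℤ) 1 * x 1 : ℂ) =
        x i := by
      fin_cases i <;> simp
    rw [h2, mul_comm] at hm
    exact_mod_cast mul_right_cancel₀ two_pi_I_ne_zero hm
  obtain ⟨p, hp⟩ := key 0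
  obtain ⟨q, hq⟩ := key 1
  refine ⟨(p, q), ?_⟩
  rw [latticeCoord_apply, hp, hq] at hx
  push_cast at hx
  simp only [hx]
  ring

/-! ### The product with the fundamental solution is nonzero -/

lemma differentiableAt_complex_of_twoDbar_eq_zero {f : ℂ → ℂ} {z : ℂ}
    (hf : DifferentiableAt ℝ f z) (h : twoDbar f z = 0) : DifferentiableAt ℂ f z := by
  rw [differentiableAt_complex_iff_differentiableAt_real]
  refine ⟨hf, ?_⟩
  have h1 := (mul_eq_zero.1 h).resolve_left (by simp)
  rw [smul_eq_mul]
  linear_combination (-I) * h1 + fderiv ℝ f z I * I_sq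

/-- A solution `g / s` of `(2D_{z̄} + k) (g / s) = 0` off the countable zero set of `s` which
vanishes on a nonempty open set vanishes identically. -/
lemma eq_zero_of_quotient {g s U : ℂ → ℂ} {k : ℂ} (hg : Differentiable ℝ g)
    (hs : Differentiable ℝ s) (hc : {z | s z = 0}.Countable) (hU : Continuous U) (hU0 : U ≠ 0)
    (heq : ∀ z, s z * (twoDbar g z + k * g z) = twoDbar s z * g z)
    (hgU : ∀ z, g z * U z = 0) : g = 0 := by
  set Ω : Set ℂ := {z | s z = 0}ᶜ with hΩ
  have hopen : IsOpen Ω := (isClosed_eq hs.continuous continuous_const).isOpen_compl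
  have hdense : Dense Ω := hc.dense_compl ℝ
  -- Removing a countable set does not disconnect the plane, so the identity theorem applies on all
  -- of `Ω`.
  have hpre : IsPreconnected Ω :=
    (hc.isPathConnected_compl_of_one_lt_rank
      (rank_real_complex ▸ Nat.one_lt_ofNat)).isConnected.isPreconnected
  -- The plane wave absorbs `k`, turning `2D_{z̄} + k` into `2D_{z̄}`. It need not be periodic,
  -- since only holomorphy on `Ω` is at stake.
  set P : ℂ → ℂ := fun z => planeWave k z * g z with hP
  have dP : Differentiable ℝ P :=
    ((contDiff_planeWave k (n := 1)).differentiable (by simp)).fun_mul hg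
  have hDP : ∀ z, twoDbar P z = planeWave k z * (twoDbar g z + k * g z) := fun z => by
    rw [hP, twoDbar_mul ((contDiff_planeWave k (n := 1)).differentiable (by simp) z) (hg z),
      twoDbar_planeWave]
    ring
  set H : ℂ → ℂ := fun z => P z * (s z)⁻¹ with hH
  have dH : ∀ z ∈ Ω, DifferentiableAt ℝ H z := fun z hz => (dP z).fun_mul ((hs z).fun_inv hz)
  have hDH : ∀ z ∈ Ω, twoDbar H z = 0 := by
    intro z hz
    have hz' : s z ≠ 0 := hz
    have h1 : (fun w => H w * s w) =ᶠ[nhds z] P := by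
      filter_upwards [hopen.mem_nhds hz] with w hw
      have hw' : s w ≠ 0 := hw
      simp only [hH]
      field_simp
    have h2 : twoDbar (fun w => H w * s w) z = twoDbar P z := by
      rw [twoDbar, h1.fderiv_eq, twoDbar]
    rw [twoDbar_mul (dH z hz) (hs z), hDP] at h2
    have h3 : s z * s z * twoDbar H z = 0 := by
      have h4 : H z * s z = planeWave k z * g z := h1.self_of_nhds
      linear_combination s z * h2 + planeWave k z * heq z - twoDbar s z * h4
    exact (mul_eq_zero.1 h3).resolve_left (mul_ne_zero hz' hz')
  have hHan : AnalyticOnNhd ℂ H Ω := by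
    refine DifferentiableOn.analyticOnNhd (fun z hz => ?_) hopen
    exact (differentiableAt_complex_of_twoDbar_eq_zero (dH z hz)
      (hDH z hz)).differentiableWithinAt
  obtain ⟨z₁, hz₁, hz₁'⟩ : ∃ z ∈ Ω, U z ≠ 0 := by
    obtain ⟨y, hy⟩ := Function.ne_iff.1 hU0
    obtain ⟨z, hz, hz'⟩ := hdense.exists_mem_open
      ((isClosed_eq hU continuous_const).isOpen_compl) ⟨y, hy⟩
    exact ⟨z, hz, hz'⟩
  have hev : H =ᶠ[nhds z₁] 0 := by
    filter_upwards [hU.continuousAt.eventually_ne hz₁'] with z hz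
    have := (mul_eq_zero.1 (hgU z)).resolve_right hz
    simp [hH, hP, this]
  have hzero := hHan.eqOn_zero_of_preconnected_of_eventuallyEq_zero hpre hz₁ hev
  refine Continuous.ext_on hdense hg.continuous continuous_const fun z hz => ?_
  have h1 := hzero hz
  have hz' : s z ≠ 0 := hz
  simpa [hH, hP, hz', planeWave_ne_zero] using h1

lemma conv_greenCoeff_ne_zero {k z₀ : ℂ} (hk : ∀ n, dualPt n + k ≠ 0) {b : (Fin 2 → ℤ) → ℂ}
    (hb : Rapid b) (hb0 : b ≠ 0) : conv (greenCoeff k z₀) b ≠ 0 := by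
  intro h
  set s := cutoff z₀ with hs
  have ss := contDiff_cutoff z₀
  have sp := isLatticePeriodic_cutoff z₀
  have ss' := contDiff_twoDbar ss
  have sp' := sp.twoDbar
  have hF := (decay_one_greenCoeff (z₀ := z₀) hk).mono zero_le_one
  have rs := rapid_coeff ss sp
  have rs' := rapid_coeff ss' sp'
  have ha : Decay 4 (conv (greenCoeff k z₀) (coeff s)) :=
    decay_conv_greenCoeff hk 4 ss sp fun j hj => iterate_twoDbar_cutoff_eq_zero z₀ hj
  have ha' : Decay 3 (conv (greenCoeff k z₀) (coeff (twoDbar s))) :=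
    decay_conv_greenCoeff hk 3 ss' sp' fun j hj =>
      iterate_twoDbar_cutoff_eq_zero z₀ (Nat.succ_lt_succ hj)
  -- Fourth order vanishing is used here: three powers of decay for summability and one more for
  -- termwise differentiation.
  have hw : Summable fun n => weight n * ‖conv (greenCoeff k z₀) (coeff s) n‖ := by
    simpa using ha.summable_weight (m := 1)
  have hsum := (ha.mono (by norm_num : 3 ≤ 4)).summable
  have hg0 : series (conv (greenCoeff k z₀) (coeff s)) = 0 := by
    refine eq_zero_of_quotient (s := s) (U := series b) (k := k) (differentiable_series hw)
      (differentiable_of_contDiff ss) (countable_cutoff_zeros z₀) (continuous_series hb.summable)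
      (fun h0 => hb0 (series_injective hb.summable (congrFun h0))) (fun z => ?_) fun z => ?_
    · have h1 := mul_conv_greenCoeff_coeff (z₀ := z₀) hk ss sp
      rw [show cutoff z₀ z₀ = 0 from iterate_twoDbar_cutoff_eq_zero z₀ (j := 0) (by norm_num)] at h1
      simp only [mul_zero, zero_add] at h1
      rw [twoDbar_series_add hw, funext h1]
      have h2 := series_conv ha'.summable rs.summable z
      have h3 := series_conv hsum rs'.summable z
      rw [series_coeff ss sp] at h2
      rw [series_coeff ss' sp'] at h3
      -- With `F` the fundamental solution, `s (2D_{z̄} + k)(F s) = s · F (2D_{z̄} s) = (2D_{z̄} s)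
      -- · F s`; there is no Dirac term because `s` vanishes at `z₀`.
      rw [mul_comm, ← h2, conv_right_comm hF rs'.summable rs.summable, h3, mul_comm]
    -- Exchanging factors, `(F s) b = (F b) s`, and `F b` is zero by assumption.
    · rw [← series_conv hsum hb.summable, conv_right_comm hF rs.summable hb.summable, h]
      simp [series, conv]
  have h0 := series_injective hsum (congrFun hg0)
  exact iterate_twoDbar_cutoff_ne_zero z₀
    (iterate_twoDbar_eq_zero_of_conv_eq_zero hk 4 ss sp h0)

/-! ### The theorem -/

lemma mem_magicSet_of_zero {V : ℂ → ℂ} (hV : ContDiff ℝ (⊤ : ℕ∞) V)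
    (hVp : IsLatticePeriodic V) {α : ℂ} {u : ℂ → ℂ} (hu : MemKerP V α 0 u) (hu0 : IsNonzero u)
    {z₀ : ℂ} (h0 : series (coeff u) z₀ = 0) (h1 : twoDbar (series (coeff u)) z₀ = 0) :
    α ∈ magicSet V := by
  intro k
  have ru := hu.rapid hV hVp
  have rV := rapid_coeff hV hVp
  have hne : coeff u ≠ 0 := by
    intro h
    refine hu0 ?_
    filter_upwards [hu.ae_eq_series hV hVp] with z hz
    rw [← hz, h]
    simp [series]
  have heq := hu.coeff_eq hV hVp
  simp only [add_zero] at heq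
  -- A bounded nonzero solution in Fourier space suffices: the bootstrap makes it smooth.
  suffices H : ∃ a, Decay 0 a ∧ a ≠ 0 ∧
      ∀ n, (dualPt n + k) ^ 2 * a n = α ^ 2 * conv a (coeff V) n by
    obtain ⟨a, ha, ha0, hae⟩ := H
    have ra := rapid_of_sq_mul_eq ha rV hae
    exact ⟨series a, memKerP_series hV hVp ra hae, isNonzero_series ra ha0⟩
  by_cases hk : ∃ l, dualPt l + k = 0
  · obtain ⟨l, hl⟩ := hk
    -- Shifting coefficients by `l` is multiplication of `u` by `chr l`, whose eigenvalue `-k`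
    -- cancels the shift in the operator.
    refine ⟨fun n => coeff u (n - l), ?_, ?_, fun n => ?_⟩
    · obtain ⟨C, hC⟩ := decay_zero_iff.1 (decay_coeff u)
      exact decay_zero_iff.2 ⟨C, fun n => hC _⟩
    · intro h
      refine hne (funext fun n => ?_)
      simpa using congrFun h (n + l)
    · rw [conv_shift, ← heq, dualPt_sub, eq_neg_of_add_eq_zero_right hl, sub_eq_add_neg]
  · push Not at hk
    have hF := decay_one_greenCoeff (z₀ := z₀) hk
    refine ⟨conv (greenCoeff k z₀) (coeff u), (hF.mono zero_le_one).conv ru,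
      conv_greenCoeff_ne_zero hk ru hne, fun n => ?_⟩
    rw [twoDbar_series ru.summable_weight] at h1
    have e1 := mul_conv_greenCoeff (z₀ := z₀) hk ru n
    have e2 := mul_conv_greenCoeff (z₀ := z₀) hk ru.dualPt_mul n
    rw [h0, mul_zero, zero_add] at e1
    rw [h1, mul_zero, zero_add] at e2
    have e3 : (fun n => dualPt n * (dualPt n * coeff u n)) =
        fun n => α ^ 2 * conv (coeff u) (coeff V) n := funext fun n => by rw [← heq]; ring
    rw [e3, conv_const_mul] at e2
    rw [sq, mul_assoc, e1, e2, conv_assoc (hF.mono zero_le_one) ru.summable rV.summable]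

end

end ScalarModel

theorem mainTheorem6 (V : ℂ → ℂ) (hV : ScalarModel.IsScalarPotential V)
    (α : ℂ) (u : ℂ → ℂ) (hu : ScalarModel.IsProtectedState V α u) :
    ∃ w : ℂ → ℂ, ContDiff ℝ (⊤ : ℕ∞) w ∧ (∀ᵐ z, w z = u z) ∧
      (α ∈ ScalarModel.magicSet V ↔ ∃ z₀ : ℂ, ScalarModel.protectedVector w z₀ = 0) := by
  have hs := hV.contDiff
  have hp := hV.periodic
  have hvec : ∀ (w : ℂ → ℂ) (z : ℂ), ScalarModel.protectedVector w z = 0 ↔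
      w z = 0 ∧ ScalarModel.twoDbar w z = 0 := by
    intro w z
    simp [ScalarModel.protectedVector, and_comm]
  refine ⟨ScalarModel.series (ScalarModel.coeff u),
    ScalarModel.contDiff_series (hu.memKer.rapid hs hp), hu.memKer.ae_eq_series hs hp, ?_⟩
  simp only [hvec]
  exact ⟨fun h => ScalarModel.exists_zero_of_mem_magicSet hs hp hu.memKer h,
    fun ⟨z₀, h0, h1⟩ => ScalarModel.mem_magicSet_of_zero hs hp hu.memKer hu.nonzero h0 h1⟩
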